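/- All algebras are associative, possibly non-unital, over $\mathbb{C}$, with non-degenerate product ($ab=0$ for all $b$, or $ba=0$ for all $b$, implies $a=0$). For such an algebra $B$, $M(B)$ denotes the multiplier algebra: pairs $m=(l,r)$ of linear maps, written $mb=l(b)$, $bm=r(b)$, with $m(bb')=(mb)b'$, $(bb')m=b(b'm)$, $(bm)b'=b(mb')$; $B$ embeds in $M(B)$. Let $(A,\Delta)$ be a regular weak multiplier Hopf algebra in the sense of Van Daele and Wang: $A$ is idempotent ($A^2=A$), $\Delta:A\to M(A\otimes A)$ is a full coproduct with counit $\varepsilon$; with $T_1(a\otimes b)=\Delta(a)(1\otimes b)$ and $T_2(a\otimes b)=(a\otimes 1)\Delta(b)$ (maps from $A\otimes A$ to itself) there is an idempotent $E\in M(A\otimes A)$ with $E(A\otimes A)=T_1(A\otimes A)$, $(A\otimes A)E=T_2(A\otimes A)$ and $(\iota\otimes\Delta)E=(E\otimes1)(1\otimes E)=(1\otimes E)(E\otimes1)$; $\ker T_i=(1-G_i)(A\otimes A)$, where $G_1,G_2$ are the linear maps on $A\otimes A$ given by $(G_1\otimes\iota)(\Delta_{13}(a)(1\otimes b\otimes c))=\Delta_{13}(a)(1\otimes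 E)(1\otimes b\otimes c)$ and $(\iota\otimes G_2)((a\otimes b\otimes 1)\Delta_{13}(c))=(a\otimes b\otimes1)(E\otimes1)\Delta_{13}(c)$; and, for regularity, $\Delta(a)(b\otimes1),(1\otimes a)\Delta(b)\in A\otimes A$ for all $a,b\in A$, and $(A,\Delta^{\rm cop})$ satisfies the same axioms. Let $R$ be a left $A$-module algebra: an algebra with a left $A$-module structure that is unital ($AR=R$) and satisfies $a(xy)=\sum(a_{(1)}x)(a_{(2)}y)$, i.e. $a(xy)=\mu(\Delta(a)(x\otimes y))$ with $\mu$ the product of $R$ and $\Delta(a)((bx)\otimes(cy))=(\Delta(a)(b\otimes c))(x\otimes y)$. Then $A$ has a bijective antipode $S:A\to A$, that is, a bijective linear map such that $R_1(a\otimes b)=\sum a_{(1)}\otimes S(a_{(2)})b$ and $R_2(a\otimes b)=\sum aS(b_{(1)})\otimes b_{(2)}$ are well-defined linear maps on $A\otimes A$ with $T_1R_1=E\,\cdot\,$, $R_1T_1=G_1$, $R_1T_1R_1=R_1$ and $T_2R_2=\,\cdot\,E$, $R_2T_2=G_2$, $R_2T_2R_2=R_2$. Moreover there is a target map $\varepsilon_t:A\to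 M(A)$, $\varepsilon_t(a)b=(\varepsilon\otimes\iota)(E(a\otimes b))$, and the $A$-module $R$ extends to a unital $M(A)$-module. Finally, there is a left $A$-module structure on $M(R)$, $(a,m)\mapsto am$, such that for all $a\in A$, $m\in M(R)$, $r\in R$: 1. it extends the action on $R\subseteq M(R)$; 2. $(am)r=\sum a_{(1)}\bigl(m(S(a_{(2)})r)\bigr)$ and $r(am)=\sum a_{(2)}\bigl((S^{-1}(a_{(1)})r)m\bigr)$, that is, for $c\in A$ and $x\in R$: $(am)(S(c)x)=\sum p\bigl(m(S(q)x)\bigr)$ where $\sum p\otimes q=(1\otimes c)\Delta(a)$, and $(S^{-1}(c)x)(am)=\sum q\bigl((S^{-1}(p)x)m\bigr)$ where $\sum p\otimes q=(c\otimes1)\Delta(a)$; 3. $a1=\varepsilon_t(a)$, i.e. $(a1)r=\varepsilon_t(a)r$ in the extended $M(A)$-module $R$; 4. it is non-degenerate: if $am=0$ for all $a\in A$, then $m=0$. -/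

import Mathlib

open scoped TensorProduct

noncomputable section

/-! ### Algebras without unit and their multiplier algebras -/

section Multipliers

variable (A : Type*) [NonUnitalRing A] [Module ℂ A] [IsScalarTower ℂ A A] [SMulCommClass ℂ A A]

/-- The product of `A` is non-degenerate (on both sides). -/
def NondegenerateProduct : Prop :=
  (∀ a : A, (∀ b : A, a * b = 0) → a = 0) ∧ (∀ a : A, (∀ b : A, b * a = 0) → a = 0)

/-- `A² = A`, where `A²` is the linear span of all products. -/
def IdempotentAlgebra : Prop :=
  Submodule.span ℂ (Set.range fun p : A × A => p.1 * p.2) = ⊤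

/-- The multiplier algebra `M(A)`: pairs `(l, r)` of a left multiplier `l` (acting as `a ↦ m a`)
and a right multiplier `r` (acting as `a ↦ a m`) with `r(a) b = a l(b)`. The product is
`(l, r) (l', r') = (l ∘ l', r' ∘ r)`, which is why the second factor is an opposite algebra. -/
def multiplierSubalgebra : Subalgebra ℂ (Module.End ℂ A × (Module.End ℂ A)ᵐᵒᵖ) where
  carrier := {m | (∀ a b, m.1 (a * b) = m.1 a * b) ∧
    (∀ a b, m.2.unop (a * b) = a * m.2.unop b) ∧
    (∀ a b, m.2.unop a * b = a * m.1 b)}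
  mul_mem' := by
    rintro x y ⟨hx1, hx2, hx3⟩ ⟨hy1, hy2, hy3⟩
    refine ⟨fun a b => ?_, fun a b => ?_, fun a b => ?_⟩
    · simp [hx1, hy1]
    · simp [hx2, hy2]
    · simp [hx3, hy3]
  add_mem' := by
    rintro x y ⟨hx1, hx2, hx3⟩ ⟨hy1, hy2, hy3⟩
    refine ⟨fun a b => ?_, fun a b => ?_, fun a b => ?_⟩
    · simp [hx1, hy1, add_mul]
    · simp [hx2, hy2, mul_add]
    · simp [hx3, hy3, mul_add, add_mul]
  algebraMap_mem' := by
    intro c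
    refine ⟨fun a b => ?_, fun a b => ?_, fun a b => ?_⟩ <;>
      simp [Algebra.algebraMap_eq_smul_one, smul_mul_assoc, mul_smul_comm]

/-- The multiplier algebra `M(A)`. -/
def MultAlg : Type _ := multiplierSubalgebra A

instance : Ring (MultAlg A) := inferInstanceAs (Ring (multiplierSubalgebra A))

instance : Algebra ℂ (MultAlg A) := inferInstanceAs (Algebra ℂ (multiplierSubalgebra A))

end Multipliers

namespace MultAlg

variable {A : Type*} [NonUnitalRing A] [Module ℂ A] [IsScalarTower ℂ A A] [SMulCommClass ℂ A A]
variable {B : Type*} [NonUnitalRing B] [Module ℂ B] [IsScalarTower ℂ B B] [SMulCommClass ℂ B B]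

/-- `m.l a` is the product `m a`. -/
def l (m : MultAlg A) : A →ₗ[ℂ] A := m.1.1

/-- `m.r a` is the product `a m`. -/
def r (m : MultAlg A) : A →ₗ[ℂ] A := m.1.2.unop

theorem l_mul (m : MultAlg A) (a b : A) : m.l (a * b) = m.l a * b := m.2.1 a b

theorem r_mul (m : MultAlg A) (a b : A) : m.r (a * b) = a * m.r b := m.2.2.1 a b

theorem r_mul_eq (m : MultAlg A) (a b : A) : m.r a * b = a * m.l b := m.2.2.2 a b

/-- Build a multiplier from its left and right parts. -/
def mk (f g : A →ₗ[ℂ] A) (h₁ : ∀ a b, f (a * b) = f a * b) (h₂ : ∀ a b, g (a * b) = a * g b)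
    (h₃ : ∀ a b, g a * b = a * f b) : MultAlg A :=
  ⟨(f, MulOpposite.op g), h₁, h₂, h₃⟩

/-- The canonical map `A → M(A)`; it sends `a` to left and right multiplication by `a`. -/
def incl (a : A) : MultAlg A :=
  mk (LinearMap.mulLeft ℂ a) (LinearMap.mulRight ℂ a)
    (fun b c => by simp [mul_assoc]) (fun b c => by simp [mul_assoc])
    (fun b c => by simp [mul_assoc])

/-- The embedding `M(A) ⊗ M(B) → M(A ⊗ B)` on elementary tensors. -/
def tmul (m : MultAlg A) (n : MultAlg B) : MultAlg (A ⊗[ℂ] B) :=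
  mk (TensorProduct.map m.l n.l) (TensorProduct.map m.r n.r)
    (fun x y => by
      induction x with
      | zero => simp
      | add x x' hx hx' => simp [add_mul, hx, hx']
      | tmul a b =>
        induction y with
        | zero => simp
        | add y y' hy hy' => simp only [mul_add, map_add, hy, hy']
        | tmul a' b' => simp [l_mul])
    (fun x y => by
      induction x with
      | zero => simp
      | add x x' hx hx' => simp [add_mul, hx, hx']
      | tmul a b =>
        induction y with
        | zero => simp
        | add y y' hy hy' => simp only [mul_add, map_add, hy, hy']
        | tmul a' b' => simp [r_mul])
    (fun x y => by
      induction x with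
      | zero => simp
      | add x x' hx hx' => simp [add_mul, hx, hx']
      | tmul a b =>
        induction y with
        | zero => simp
        | add y y' hy hy' => simp only [mul_add, map_add, hy, hy']
        | tmul a' b' => simp [r_mul_eq])

/-- Transport of multipliers along a multiplicative linear isomorphism. -/
def transport (e : A ≃ₗ[ℂ] B) (he : ∀ x y, e (x * y) = e x * e y) (m : MultAlg A) : MultAlg B :=
  have he' : ∀ x y, e.symm (x * y) = e.symm x * e.symm y := fun x y => by
    apply e.injective; simp [he]
  mk (e.toLinearMap ∘ₗ m.l ∘ₗ e.symm.toLinearMap) (e.toLinearMap ∘ₗ m.r ∘ₗ e.symm.toLinearMap)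
    (fun x y => by simp [he, he', l_mul]) (fun x y => by simp [he, he', r_mul])
    (fun x y => by
      have h := congrArg e (m.r_mul_eq (e.symm x) (e.symm y))
      simpa [he] using h)

variable (A) in
theorem assoc_mul (x y : (A ⊗[ℂ] A) ⊗[ℂ] A) :
    TensorProduct.assoc ℂ A A A (x * y) =
      TensorProduct.assoc ℂ A A A x * TensorProduct.assoc ℂ A A A y := by
  induction x with
  | zero => simp
  | add x x' hx hx' => simp [add_mul, hx, hx']
  | tmul u c =>
    induction u with
    | zero => simp
    | add u u' hu hu' => simp only [TensorProduct.add_tmul, add_mul, map_add, hu, hu']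
    | tmul a b =>
      induction y with
      | zero => simp
      | add y y' hy hy' => simp only [mul_add, map_add, hy, hy']
      | tmul v c' =>
        induction v with
        | zero => simp
        | add v v' hv hv' => simp only [TensorProduct.add_tmul, mul_add, map_add, hv, hv']
        | tmul a' b' => simp

/-- For `E ∈ M(A ⊗ A)`, the multiplier `E ⊗ 1` of `A ⊗ A ⊗ A`. -/
def leg₁₂ (E : MultAlg (A ⊗[ℂ] A)) : MultAlg (A ⊗[ℂ] (A ⊗[ℂ] A)) :=
  transport (TensorProduct.assoc ℂ A A A) (assoc_mul A) (tmul E (1 : MultAlg A))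

/-- For `E ∈ M(A ⊗ A)`, the multiplier `1 ⊗ E` of `A ⊗ A ⊗ A`. -/
def leg₂₃ (E : MultAlg (A ⊗[ℂ] A)) : MultAlg (A ⊗[ℂ] (A ⊗[ℂ] A)) :=
  tmul (1 : MultAlg A) E

end MultAlg

open MultAlg

/-! ### Weak multiplier Hopf algebras -/

section Legs

variable {A : Type*} [AddCommGroup A] [Module ℂ A]

/-- `(ω ⊗ ι) : A ⊗ A → A` for a linear functional `ω`. -/
def sliceLeft (ω : A →ₗ[ℂ] ℂ) : A ⊗[ℂ] A →ₗ[ℂ] A :=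
  (TensorProduct.lid ℂ A).toLinearMap ∘ₗ TensorProduct.map ω LinearMap.id

/-- `(ι ⊗ ω) : A ⊗ A → A` for a linear functional `ω`. -/
def sliceRight (ω : A →ₗ[ℂ] ℂ) : A ⊗[ℂ] A →ₗ[ℂ] A :=
  (TensorProduct.rid ℂ A).toLinearMap ∘ₗ TensorProduct.map LinearMap.id ω

/-- With `T(a ⊗ c) = Δ(a)(1 ⊗ c)`, this is
`a ⊗ (b ⊗ c) ↦ Δ₁₃(a)(1 ⊗ b ⊗ c) = ∑ (a₍₁₎ ⊗ b) ⊗ a₍₂₎c`. -/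
def delta₁₃Right (T : A ⊗[ℂ] A →ₗ[ℂ] A ⊗[ℂ] A) :
    A ⊗[ℂ] (A ⊗[ℂ] A) →ₗ[ℂ] (A ⊗[ℂ] A) ⊗[ℂ] A :=
  (TensorProduct.assoc ℂ A A A).symm.toLinearMap ∘ₗ
    (TensorProduct.leftComm ℂ A A A).toLinearMap ∘ₗ
      TensorProduct.map LinearMap.id T ∘ₗ (TensorProduct.leftComm ℂ A A A).toLinearMap

/-- With `T(a ⊗ c) = (a ⊗ 1)Δ(c)`, this is
`(a ⊗ b) ⊗ c ↦ (a ⊗ b ⊗ 1)Δ₁₃(c) = ∑ a c₍₁₎ ⊗ (b ⊗ c₍₂₎)`. -/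
def delta₁₃Left (T : A ⊗[ℂ] A →ₗ[ℂ] A ⊗[ℂ] A) :
    (A ⊗[ℂ] A) ⊗[ℂ] A →ₗ[ℂ] A ⊗[ℂ] (A ⊗[ℂ] A) :=
  (TensorProduct.assoc ℂ A A A).toLinearMap ∘ₗ
    (TensorProduct.rightComm ℂ A A A).toLinearMap ∘ₗ
      TensorProduct.map T LinearMap.id ∘ₗ (TensorProduct.rightComm ℂ A A A).toLinearMap

end Legs

/-- A coproduct `Δ : A → M(A ⊗ A)`. The canonical maps `T₁`, `T₂` are determined by `Δ` when the
product of `A` is non-degenerate; carrying them expresses that `Δ(a)(1 ⊗ b)` and `(a ⊗ 1)Δ(b)`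
lie in `A ⊗ A`. -/
structure Coproduct (A : Type*) [NonUnitalRing A] [Module ℂ A] [IsScalarTower ℂ A A]
    [SMulCommClass ℂ A A] where
  Δ : A →ₙₐ[ℂ] MultAlg (A ⊗[ℂ] A)
  T₁ : A ⊗[ℂ] A →ₗ[ℂ] A ⊗[ℂ] A
  T₂ : A ⊗[ℂ] A →ₗ[ℂ] A ⊗[ℂ] A
  /-- `T₁(a ⊗ b) = Δ(a)(1 ⊗ b)`. -/
  T₁_spec : ∀ a b, incl (T₁ (a ⊗ₜ b)) = Δ a * tmul 1 (incl b)
  /-- `T₂(a ⊗ b) = (a ⊗ 1)Δ(b)`. -/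
  T₂_spec : ∀ a b, incl (T₂ (a ⊗ₜ b)) = tmul (incl a) 1 * Δ b
  /-- `(c ⊗ 1 ⊗ 1)(Δ ⊗ ι)(Δ(a)(1 ⊗ b)) = (ι ⊗ Δ)((c ⊗ 1)Δ(a))(1 ⊗ 1 ⊗ b)`. -/
  coassoc : ∀ a b c,
    TensorProduct.assoc ℂ A A A
        (TensorProduct.map (T₂ ∘ₗ TensorProduct.mk ℂ A A c) LinearMap.id (T₁ (a ⊗ₜ b))) =
      TensorProduct.map LinearMap.id (T₁ ∘ₗ (TensorProduct.mk ℂ A A).flip b) (T₂ (c ⊗ₜ a))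

/-- A weak multiplier Hopf algebra. The maps `T₁`, `T₂` and the counit, `E`, `G₁`, `G₂` are all
uniquely determined by the coproduct. -/
structure WeakMultiplierHopfAlgebra (A : Type*) [NonUnitalRing A] [Module ℂ A]
    [IsScalarTower ℂ A A] [SMulCommClass ℂ A A] extends Coproduct A where
  nondegenerate : NondegenerateProduct A
  idempotent : IdempotentAlgebra A
  /-- The left leg of `Δ` is all of `A`. -/
  full_left : ∀ V : Submodule ℂ A,
    LinearMap.range T₁ ≤
      LinearMap.range (TensorProduct.map V.subtype (LinearMap.id : A →ₗ[ℂ] A)) → V = ⊤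
  /-- The right leg of `Δ` is all of `A`. -/
  full_right : ∀ W : Submodule ℂ A,
    LinearMap.range T₂ ≤
      LinearMap.range (TensorProduct.map (LinearMap.id : A →ₗ[ℂ] A) W.subtype) → W = ⊤
  /-- The counit. -/
  ε : A →ₗ[ℂ] ℂ
  counit_left : ∀ a b, sliceLeft ε (T₁ (a ⊗ₜ b)) = a * b
  counit_right : ∀ a b, sliceRight ε (T₂ (a ⊗ₜ b)) = a * b
  /-- The canonical idempotent. -/
  E : MultAlg (A ⊗[ℂ] A)
  E_idempotent : E * E = E
  /-- `E(A ⊗ A) = T₁(A ⊗ A)`. -/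
  range_T₁ : LinearMap.range E.l = LinearMap.range T₁
  /-- `(A ⊗ A)E = T₂(A ⊗ A)`. -/
  range_T₂ : LinearMap.range E.r = LinearMap.range T₂
  /-- `(ι ⊗ Δ)E = (E ⊗ 1)(1 ⊗ E) = (1 ⊗ E)(E ⊗ 1)`, where `Φ` is the (unique) extension of
  `ι ⊗ Δ` to a homomorphism on `M(A ⊗ A)` that maps `1` to `1 ⊗ E`. -/
  id_tensor_Δ_E : ∃ Φ : MultAlg (A ⊗[ℂ] A) →ₙₐ[ℂ] MultAlg (A ⊗[ℂ] (A ⊗[ℂ] A)),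
    (∀ a b : A, Φ (incl (a ⊗ₜ b)) = tmul (incl a) (Δ b)) ∧ Φ 1 = leg₂₃ E ∧
      Φ E = leg₁₂ E * leg₂₃ E ∧ Φ E = leg₂₃ E * leg₁₂ E
  G₁ : A ⊗[ℂ] A →ₗ[ℂ] A ⊗[ℂ] A
  G₂ : A ⊗[ℂ] A →ₗ[ℂ] A ⊗[ℂ] A
  /-- `(G₁ ⊗ ι)(Δ₁₃(a)(1 ⊗ b ⊗ c)) = Δ₁₃(a)(1 ⊗ E)(1 ⊗ b ⊗ c)`. -/
  G₁_spec : ∀ a b c, TensorProduct.map G₁ LinearMap.id (delta₁₃Right T₁ (a ⊗ₜ (b ⊗ₜ c))) =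
    delta₁₃Right T₁ (a ⊗ₜ E.l (b ⊗ₜ c))
  /-- `(ι ⊗ G₂)((a ⊗ b ⊗ 1)Δ₁₃(c)) = (a ⊗ b ⊗ 1)(E ⊗ 1)Δ₁₃(c)`. -/
  G₂_spec : ∀ a b c, TensorProduct.map LinearMap.id G₂ (delta₁₃Left T₂ ((a ⊗ₜ b) ⊗ₜ c)) =
    delta₁₃Left T₂ (E.r (a ⊗ₜ b) ⊗ₜ c)
  ker_T₁ : LinearMap.ker T₁ = LinearMap.range (LinearMap.id - G₁)
  ker_T₂ : LinearMap.ker T₂ = LinearMap.range (LinearMap.id - G₂)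

/-- A regular weak multiplier Hopf algebra: the coproduct is regular and `(A, Δᶜᵒᵖ)` is again a
weak multiplier Hopf algebra. -/
structure RegularWeakMultiplierHopfAlgebra (A : Type*) [NonUnitalRing A] [Module ℂ A]
    [IsScalarTower ℂ A A] [SMulCommClass ℂ A A] extends WeakMultiplierHopfAlgebra A where
  T₃ : A ⊗[ℂ] A →ₗ[ℂ] A ⊗[ℂ] A
  T₄ : A ⊗[ℂ] A →ₗ[ℂ] A ⊗[ℂ] A
  /-- `T₃(a ⊗ b) = (1 ⊗ b)Δ(a)`. -/
  T₃_spec : ∀ a b, incl (T₃ (a ⊗ₜ b)) = tmul 1 (incl b) * Δ a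
  /-- `T₄(a ⊗ b) = Δ(b)(a ⊗ 1)`. -/
  T₄_spec : ∀ a b, incl (T₄ (a ⊗ₜ b)) = Δ b * tmul (incl a) 1
  /-- `Δᶜᵒᵖ(a)x = fl(Δ(a) fl(x))` and `xΔᶜᵒᵖ(a) = fl(fl(x)Δ(a))`. -/
  cop : ∃ K : WeakMultiplierHopfAlgebra A, ∀ a x,
    (K.Δ a).l x = TensorProduct.comm ℂ A A ((Δ a).l (TensorProduct.comm ℂ A A x)) ∧
    (K.Δ a).r x = TensorProduct.comm ℂ A A ((Δ a).r (TensorProduct.comm ℂ A A x))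

namespace RegularWeakMultiplierHopfAlgebra

variable {A : Type*} [NonUnitalRing A] [Module ℂ A] [IsScalarTower ℂ A A] [SMulCommClass ℂ A A]

/-- `S` is the antipode: `R₁(a ⊗ b) = ∑ a₍₁₎ ⊗ S(a₍₂₎)b` and `R₂(a ⊗ b) = ∑ aS(b₍₁₎) ⊗ b₍₂₎` are
the generalized inverses of the canonical maps `T₁`, `T₂` that belong to the projections given by
`E` and `G₁`, respectively `E` and `G₂`. The two Sweedler formulas are covered by an extra factor
`c`: the first is multiplied by `c ⊗ 1` from the left, the second by `1 ⊗ c` from the right. -/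
def IsAntipode (H : RegularWeakMultiplierHopfAlgebra A) (S : A ≃ₗ[ℂ] A) : Prop :=
  ∃ R₁ R₂ : A ⊗[ℂ] A →ₗ[ℂ] A ⊗[ℂ] A,
    (H.T₁ ∘ₗ R₁ = H.E.l ∧ R₁ ∘ₗ H.T₁ = H.G₁ ∧ R₁ ∘ₗ H.T₁ ∘ₗ R₁ = R₁) ∧
    (H.T₂ ∘ₗ R₂ = H.E.r ∧ R₂ ∘ₗ H.T₂ = H.G₂ ∧ R₂ ∘ₗ H.T₂ ∘ₗ R₂ = R₂) ∧
    (∀ a b c, (tmul (incl c) 1).l (R₁ (a ⊗ₜ b)) =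
      TensorProduct.map LinearMap.id (LinearMap.mulRight ℂ b ∘ₗ S.toLinearMap)
        (H.T₂ (c ⊗ₜ a))) ∧
    (∀ a b c, (tmul 1 (incl c)).r (R₂ (a ⊗ₜ b)) =
      TensorProduct.map (LinearMap.mulLeft ℂ a ∘ₗ S.toLinearMap) LinearMap.id
        (H.T₁ (b ⊗ₜ c)))

/-- `εt` is the target map `A → M(A)`, `ε_t(a) = (ε ⊗ ι)(E(a ⊗ 1))`. -/
def IsTargetMap (H : RegularWeakMultiplierHopfAlgebra A) (εt : A →ₗ[ℂ] MultAlg A) : Prop :=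
  ∀ a b, (εt a).l b = sliceLeft H.ε (H.E.l (a ⊗ₜ b))

end RegularWeakMultiplierHopfAlgebra

/-! ### Module algebras -/

section Actions

variable {A : Type*} [NonUnitalRing A] [Module ℂ A] [IsScalarTower ℂ A A] [SMulCommClass ℂ A A]

/-- A bilinear map `A × V → V`, `(a, v) ↦ a v`, is a left `A`-module structure. -/
def IsLeftAction {V : Type*} [AddCommGroup V] [Module ℂ V] (act : A →ₗ[ℂ] V →ₗ[ℂ] V) : Prop :=
  ∀ a b v, act (a * b) v = act a (act b v)

/-- The module is unital: `A V = V`. -/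
def IsUnitalAction {V : Type*} [AddCommGroup V] [Module ℂ V] (act : A →ₗ[ℂ] V →ₗ[ℂ] V) : Prop :=
  Submodule.span ℂ (Set.range fun p : A × V => act p.1 p.2) = ⊤

/-- The module is non-degenerate: `A v = 0` implies `v = 0`. -/
def IsNondegenerateAction {V : Type*} [AddCommGroup V] [Module ℂ V]
    (act : A →ₗ[ℂ] V →ₗ[ℂ] V) : Prop :=
  ∀ v, (∀ a, act a v = 0) → v = 0

/-- `R` is a left `A`-module algebra. The last condition is `a(xy) = ∑ (a₍₁₎x)(a₍₂₎y)`, that is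
`a(xy) = m(Δ(a)(x ⊗ y))` with `m` the product of `R` and `Δ(a) ∈ M(A ⊗ A)` acting on the unital
`A ⊗ A`-module `R ⊗ R` by `Δ(a)(bx ⊗ cy) = (Δ(a)(b ⊗ c))(x ⊗ y)`. -/
structure IsModuleAlgebra (H : WeakMultiplierHopfAlgebra A) {R : Type*} [NonUnitalRing R]
    [Module ℂ R] [IsScalarTower ℂ R R] [SMulCommClass ℂ R R]
    (act : A →ₗ[ℂ] R →ₗ[ℂ] R) : Prop where
  nondegenerate : NondegenerateProduct R
  isLeftAction : IsLeftAction act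
  isUnital : IsUnitalAction act
  act_mul : ∀ (a b c : A) (x y : R), act a (act b x * act c y) =
    LinearMap.mul' ℂ R
      (TensorProduct.map (act.flip x) (act.flip y) ((H.Δ a).l (b ⊗ₜ c)))

/-- `ρ` is the extension of a unital `A`-module to a unital `M(A)`-module. -/
def IsMultiplierExtension {V : Type*} [AddCommGroup V] [Module ℂ V]
    (act : A →ₗ[ℂ] V →ₗ[ℂ] V) (ρ : MultAlg A →ₐ[ℂ] Module.End ℂ V) : Prop :=
  ∀ a, ρ (incl a) = act a

end Actions

end

set_option linter.unusedSectionVars false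

/-! Everything rests on the calculus of operators on neighbouring legs of a threefold tensor
product. Coassociativity says that `T₂` on the first two legs commutes with `T₁` on the last two
(`LegComm`). The projections given by `E` inherit such commutations from the axiom on (ι ⊗ Δ)E, used
for `H` and for its co-opposite `K`. The projections `G₁`, `G₂` inherit them because fullness
determines them by `T₁`, `T₂` and `E` (`legComm_proj`). A generalized inverse commutes with whatever
commutes with its map and its two projections (`commute_of_genInv`), so R₁ and R₂ inherit them as
well.

Applying ε to the middle leg turns a commutation into a formula: an operator commuting with `T₂` has
the form u ⊗ y ↦ ∑ u₍₁₎ ⊗ g_y(u₍₂₎) (`lm₁_of_legComm`). For R₁ this gives σ(u)y = "S(u)y", where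
σ(u) is at first only a left multiplier. With σ' the analogue for `K`, the relation σ(σ'(a)b) =
σ(b)a and the surjectivity of σ' put S(u) in A and make S' the inverse of S. Left and right antipode
agree by the usual convolution argument.

Non-degeneracy of R as an A-module comes from local units: a ∈ Aa for every a (`mem_leftIdeal`),
proved by computing modulo Aa.

For the module algebra the key identity is (aw)(cy) = ∑ a₍₁₎(w · S(a₍₂₎)cy) (`apply_act`). It is
applied to the product of R over `H` and to the opposite product over `K`. The left and right parts
of am are defined by R₁ and by its analogue R₁' for `K`. They fit together because the flip of R₁'
on legs 1, 2 commutes with R₁ on legs 2, 3. The action is multiplicative by `R₁_mul_tmul`, and a1 =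
ε_t(a) because E = T₁R₁. If Am = 0, then p(m(qx)) = 0 for all p, q: replacing p ⊗ q by G₁(p ⊗ q) =
R₁T₁(p ⊗ q) does not change this expression (`sandwich_l_G₁`). -/

noncomputable section

open MultAlg

/-! ### Slices and separation in tensor products -/

section Slices

variable {V W V' W' : Type*} [AddCommGroup V] [Module ℂ V] [AddCommGroup W] [Module ℂ W]
  [AddCommGroup V'] [Module ℂ V'] [AddCommGroup W'] [Module ℂ W']

/-- `ω ⊗ ι : V ⊗ W → W`. -/
def slL (ω : V →ₗ[ℂ] ℂ) : V ⊗[ℂ] W →ₗ[ℂ] W :=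
  (TensorProduct.lid ℂ W).toLinearMap ∘ₗ TensorProduct.map ω LinearMap.id

/-- `ι ⊗ ω : V ⊗ W → V`. -/
def slR (ω : W →ₗ[ℂ] ℂ) : V ⊗[ℂ] W →ₗ[ℂ] V :=
  (TensorProduct.rid ℂ V).toLinearMap ∘ₗ TensorProduct.map LinearMap.id ω

@[simp] theorem slL_tmul (ω : V →ₗ[ℂ] ℂ) (v : V) (w : W) : slL ω (v ⊗ₜ[ℂ] w) = ω v • w := by
  simp [slL]

@[simp] theorem slR_tmul (ω : W →ₗ[ℂ] ℂ) (v : V) (w : W) : slR ω (v ⊗ₜ[ℂ] w) = ω w • v := by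
  simp [slR]

theorem slL_lTensor (ω : V →ₗ[ℂ] ℂ) (f : W →ₗ[ℂ] W') (z : V ⊗[ℂ] W) :
    slL ω (f.lTensor V z) = f (slL ω z) := by
  have : slL ω ∘ₗ f.lTensor V = f ∘ₗ slL ω := by ext; simp
  exact LinearMap.congr_fun this z

theorem slR_rTensor (ω : W →ₗ[ℂ] ℂ) (f : V →ₗ[ℂ] V') (z : V ⊗[ℂ] W) :
    slR ω (f.rTensor W z) = f (slR ω z) := by
  have : slR ω ∘ₗ f.rTensor W = f ∘ₗ slR ω := by ext; simp
  exact LinearMap.congr_fun this z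

theorem slR_lTensor (ω : W' →ₗ[ℂ] ℂ) (f : W →ₗ[ℂ] W') (z : V ⊗[ℂ] W) :
    slR ω (f.lTensor V z) = slR (ω ∘ₗ f) z := by
  have : slR ω ∘ₗ f.lTensor V = slR (ω ∘ₗ f) := by ext; simp
  exact LinearMap.congr_fun this z

theorem slL_comm (ω : W →ₗ[ℂ] ℂ) (z : V ⊗[ℂ] W) :
    slL ω (TensorProduct.comm ℂ V W z) = slR ω z := by
  have : slL ω ∘ₗ (TensorProduct.comm ℂ V W).toLinearMap = slR ω := by ext; simp
  exact LinearMap.congr_fun this z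

theorem slR_comm (ω : V →ₗ[ℂ] ℂ) (z : V ⊗[ℂ] W) :
    slR ω (TensorProduct.comm ℂ V W z) = slL ω z := by
  have : slR ω ∘ₗ (TensorProduct.comm ℂ V W).toLinearMap = slL ω := by ext; simp
  exact LinearMap.congr_fun this z

/-- The slices along the coordinate functionals of a basis of W are the coordinates of z. -/
theorem eq_zero_of_slR (z : V ⊗[ℂ] W) (h : ∀ ω : W →ₗ[ℂ] ℂ, slR ω z = 0) : z = 0 := by
  classical
  let b := Module.Basis.ofVectorSpace ℂ W
  apply (TensorProduct.equivFinsuppOfBasisRight (M := V) b).injective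
  rw [map_zero]
  ext i
  have key : ∀ z : V ⊗[ℂ] W, TensorProduct.equivFinsuppOfBasisRight b z i = slR (b.coord i) z := by
    intro z
    induction z with
    | zero => simp
    | add x y hx hy => simp [hx, hy]
    | tmul v w => simp
  rw [key, h]; rfl

theorem eq_zero_of_slL (z : V ⊗[ℂ] W) (h : ∀ ω : V →ₗ[ℂ] ℂ, slL ω z = 0) : z = 0 := by
  apply (TensorProduct.comm ℂ V W).injective
  rw [map_zero]
  apply eq_zero_of_slR
  intro ω
  rw [slR_comm, h]

theorem eq_of_slR {z z' : V ⊗[ℂ] W} (h : ∀ ω : W →ₗ[ℂ] ℂ, slR ω z = slR ω z') : z = z' := by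
  rw [← sub_eq_zero]
  exact eq_zero_of_slR _ fun ω => by rw [map_sub, h, sub_self]

/-- Slicing the second leg reduces joint injectivity of the maps f i ⊗ ι to that of the f i. This is
how non-degeneracy of the product is used in a single leg. -/
theorem eq_of_rTensor {ι : Sort*} (f : ι → V →ₗ[ℂ] V') (hf : ∀ v, (∀ i, f i v = 0) → v = 0)
    {z z' : V ⊗[ℂ] W} (h : ∀ i, (f i).rTensor W z = (f i).rTensor W z') : z = z' := by
  rw [← sub_eq_zero]
  refine eq_zero_of_slR _ fun ω => hf _ fun i => ?_
  rw [← slR_rTensor, map_sub, h, sub_self, map_zero]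

theorem eq_of_lTensor {ι : Sort*} (f : ι → W →ₗ[ℂ] W') (hf : ∀ v, (∀ i, f i v = 0) → v = 0)
    {z z' : V ⊗[ℂ] W} (h : ∀ i, (f i).lTensor V z = (f i).lTensor V z') : z = z' := by
  rw [← sub_eq_zero]
  refine eq_zero_of_slL _ fun ω => hf _ fun i => ?_
  rw [← slL_lTensor, map_sub, h, sub_self, map_zero]

/-- If `h` annihilates all slices of `z`, then contracting `z` with `h` gives zero. -/
theorem lift_eq_zero_of_slR (h : V →ₗ[ℂ] W →ₗ[ℂ] W') (z : V ⊗[ℂ] W)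
    (hz : ∀ ω : W →ₗ[ℂ] ℂ, h (slR ω z) = 0) : TensorProduct.lift h z = 0 := by
  have h0 : h.rTensor W z = 0 := eq_zero_of_slR _ fun ω => by rw [slR_rTensor, hz]
  have h1 : TensorProduct.lift h = TensorProduct.lift LinearMap.id ∘ₗ h.rTensor W := by ext; simp
  rw [h1, LinearMap.comp_apply, h0, map_zero]

end Slices

/-! ### Generalized inverses -/

section GeneralizedInverse

variable {V : Type*} [AddCommGroup V] [Module ℂ V]

/-- `R` is the generalized inverse of `T` belonging to the projections `P` and `G`. -/
structure IsGenInv (T P G R : Module.End ℂ V) : Prop where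
  mul_right : T * R = P
  mul_left : R * T = G
  refl : R * T * R = R

/-- The inverse is GsP with s any linear section of T over its range. Two preimages differ by an
element of ker T = ran(1 − G), which G kills, so Gs does not depend on s. -/
theorem exists_isGenInv {T P G : Module.End ℂ V} (hP : P * P = P)
    (hPT : LinearMap.range P = LinearMap.range T) (hG : G * G = G)
    (hGT : LinearMap.ker T = LinearMap.range (LinearMap.id - G)) :
    ∃ R, IsGenInv T P G R := by
  have hTG : T * G = T := by
    ext v
    have : (LinearMap.id - G : V →ₗ[ℂ] V) v ∈ LinearMap.ker T :=
      hGT ▸ LinearMap.mem_range_self _ v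
    simp only [LinearMap.mem_ker, LinearMap.sub_apply, LinearMap.id_apply, map_sub,
      sub_eq_zero] at this
    simpa using this.symm
  have hker : ∀ v, T v = 0 → G v = 0 := by
    intro v hv
    have : v ∈ LinearMap.range (LinearMap.id - G) := hGT ▸ hv
    obtain ⟨w, rfl⟩ := this
    have := LinearMap.congr_fun hG w
    simp only [Module.End.mul_apply] at this
    simp [this]
  obtain ⟨s, hs⟩ := T.rangeRestrict.exists_rightInverse_of_surjective T.range_rangeRestrict
  let P' : V →ₗ[ℂ] LinearMap.range T := P.codRestrict _ fun v => hPT ▸ LinearMap.mem_range_self P v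
  have hs' : ∀ w, T (s w) = w := fun w => congrArg Subtype.val (LinearMap.congr_fun hs w)
  have hPT' : ∀ v, P (T v) = T v := by
    intro v
    have : T v ∈ LinearMap.range P := hPT ▸ LinearMap.mem_range_self T v
    obtain ⟨w, hw⟩ := this
    rw [← hw]
    exact LinearMap.congr_fun hP w
  have h1 : T * (G ∘ₗ s ∘ₗ P') = P := by
    ext v
    have := LinearMap.congr_fun hTG (s (P' v))
    simp only [Module.End.mul_apply] at this
    simp only [Module.End.mul_apply, LinearMap.comp_apply, this, hs']
    rfl
  have h2 : (G ∘ₗ s ∘ₗ P') * T = G := by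
    ext v
    simp only [Module.End.mul_apply, LinearMap.comp_apply]
    rw [← sub_eq_zero, ← map_sub]
    apply hker
    rw [map_sub, hs']
    change P (T v) - T v = 0
    rw [hPT', sub_self]
  refine ⟨G ∘ₗ s ∘ₗ P', h1, h2, ?_⟩
  rw [h2]
  change G ∘ₗ G ∘ₗ _ = _
  rw [← LinearMap.comp_assoc]
  exact congrArg (fun f => f ∘ₗ (s ∘ₗ P')) hG

/-- XR = XGR = GXR = RTXR = RXTR = RXP = RPX = RX. Stating it in a monoid lets it apply to operators
on two legs and on three. -/
theorem commute_of_genInv {M : Type*} [Monoid M] {T P G R X : M} (h₁ : T * R = P)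
    (h₂ : R * T = G) (h₃ : R * T * R = R) (hT : Commute X T) (hP : Commute X P)
    (hG : Commute X G) : Commute X R := by
  calc X * R = X * G * R := by rw [mul_assoc, ← h₂, h₃]
    _ = R * (T * X) * R := by rw [hG.eq, ← h₂]; simp only [mul_assoc]
    _ = R * X * P := by rw [← hT.eq, ← h₁]; simp only [mul_assoc]
    _ = R * T * R * X := by rw [mul_assoc, hP.eq, ← h₁]; simp only [mul_assoc]
    _ = R * X := by rw [h₃]

namespace IsGenInv

variable {T P G R : Module.End ℂ V} (h : IsGenInv T P G R)
include h

theorem apply_right (v : V) : T (R v) = P v := LinearMap.congr_fun h.mul_right v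

theorem apply_left (v : V) : R (T v) = G v := LinearMap.congr_fun h.mul_left v

theorem proj_left (v : V) : G (R v) = R v := by
  rw [← h.apply_left]
  exact LinearMap.congr_fun h.refl v

theorem proj_right (v : V) : R (P v) = R v := by
  rw [← h.apply_right, h.apply_left, h.proj_left]

end IsGenInv

end GeneralizedInverse

/-! ### Operators on legs of a threefold tensor product -/

section LegOperators

variable {A M N : Type*} [AddCommGroup A] [Module ℂ A] [AddCommGroup M] [Module ℂ M]
  [AddCommGroup N] [Module ℂ N]

variable (M) in
/-- The operator `f` on the first two legs. -/
def opL (f : A ⊗[ℂ] A →ₗ[ℂ] A ⊗[ℂ] A) : Module.End ℂ (A ⊗[ℂ] (A ⊗[ℂ] M)) :=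
  (TensorProduct.assoc ℂ A A M).toLinearMap ∘ₗ f.rTensor M ∘ₗ
    (TensorProduct.assoc ℂ A A M).symm.toLinearMap

@[simp] theorem opL_tmul (f : A ⊗[ℂ] A →ₗ[ℂ] A ⊗[ℂ] A) (x a : A) (m : M) :
    opL M f (x ⊗ₜ (a ⊗ₜ m)) = TensorProduct.assoc ℂ A A M (f (x ⊗ₜ a) ⊗ₜ m) := by
  simp [opL]

theorem opL_assoc (f : A ⊗[ℂ] A →ₗ[ℂ] A ⊗[ℂ] A) (z : A ⊗[ℂ] A) (m : M) :
    opL M f (TensorProduct.assoc ℂ A A M (z ⊗ₜ m)) = TensorProduct.assoc ℂ A A M (f z ⊗ₜ m) := by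
  simp [opL]

theorem opL_mul (f g : Module.End ℂ (A ⊗[ℂ] A)) : opL M (f * g) = opL M f * opL M g := by
  ext x a m
  simp [Module.End.mul_apply, opL_assoc]

theorem lTensor_lTensor_assoc (k : M →ₗ[ℂ] N) (z : A ⊗[ℂ] A) (m : M) :
    (k.lTensor A).lTensor A (TensorProduct.assoc ℂ A A M (z ⊗ₜ m)) =
      TensorProduct.assoc ℂ A A N (z ⊗ₜ k m) := by
  induction z with
  | zero => simp
  | add x y hx hy => simp only [TensorProduct.add_tmul, map_add, hx, hy]
  | tmul x a => simp

theorem opL_lTensor_lTensor (f : A ⊗[ℂ] A →ₗ[ℂ] A ⊗[ℂ] A) (k : M →ₗ[ℂ] N)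
    (w : A ⊗[ℂ] (A ⊗[ℂ] M)) :
    opL N f ((k.lTensor A).lTensor A w) = (k.lTensor A).lTensor A (opL M f w) := by
  have : opL N f ∘ₗ (k.lTensor A).lTensor A = (k.lTensor A).lTensor A ∘ₗ opL M f := by
    ext x a m
    simp [lTensor_lTensor_assoc]
  exact LinearMap.congr_fun this w

/-- `f` on the first two legs commutes with `g` on the last two legs. -/
def LegComm (f g : Module.End ℂ (A ⊗[ℂ] A)) : Prop :=
  Commute (opL A f) (g.lTensor A : Module.End ℂ (A ⊗[ℂ] (A ⊗[ℂ] A)))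

theorem LegComm.apply {f g : Module.End ℂ (A ⊗[ℂ] A)} (h : LegComm f g) (x : A)
    (z : A ⊗[ℂ] A) : opL A f (x ⊗ₜ g z) = g.lTensor A (opL A f (x ⊗ₜ z)) :=
  LinearMap.congr_fun h.eq (x ⊗ₜ z)

theorem LegComm.of_apply {f g : Module.End ℂ (A ⊗[ℂ] A)}
    (h : ∀ x a y, opL A f (x ⊗ₜ g (a ⊗ₜ y)) =
      g.lTensor A (TensorProduct.assoc ℂ A A A (f (x ⊗ₜ a) ⊗ₜ y))) : LegComm f g := by
  unfold LegComm Commute SemiconjBy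
  ext x a y
  simp [Module.End.mul_apply, h]

theorem LegComm.genInv_right {f T P G R : Module.End ℂ (A ⊗[ℂ] A)} (hR : IsGenInv T P G R)
    (hT : LegComm f T) (hP : LegComm f P) (hG : LegComm f G) : LegComm f R := by
  refine commute_of_genInv (T := T.lTensor A) (P := P.lTensor A) (G := G.lTensor A)
    ?_ ?_ ?_ hT hP hG
  · rw [← hR.mul_right]; exact (LinearMap.lTensor_mul A T R).symm
  · rw [← hR.mul_left]; exact (LinearMap.lTensor_mul A R T).symm
  · conv_rhs => rw [← hR.refl]
    rw [LinearMap.lTensor_mul, LinearMap.lTensor_mul]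

theorem LegComm.genInv_left {g T P G R : Module.End ℂ (A ⊗[ℂ] A)} (hR : IsGenInv T P G R)
    (hT : LegComm T g) (hP : LegComm P g) (hG : LegComm G g) : LegComm R g := by
  refine (commute_of_genInv (T := opL A T) (P := opL A P) (G := opL A G)
    ?_ ?_ ?_ hT.symm hP.symm hG.symm).symm
  · rw [← hR.mul_right, opL_mul]
  · rw [← hR.mul_left, opL_mul]
  · rw [← opL_mul, ← opL_mul, hR.refl]

/-- The conjugate of an operator on `A ⊗ A` by the flip. -/
def flipConj (f : Module.End ℂ (A ⊗[ℂ] A)) : Module.End ℂ (A ⊗[ℂ] A) :=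
  (TensorProduct.comm ℂ A A).toLinearMap ∘ₗ f ∘ₗ (TensorProduct.comm ℂ A A).toLinearMap

@[simp] theorem flipConj_tmul (f : Module.End ℂ (A ⊗[ℂ] A)) (a b : A) :
    flipConj f (a ⊗ₜ b) = TensorProduct.comm ℂ A A (f (b ⊗ₜ a)) := by
  simp [flipConj]

theorem flipConj_apply (f : Module.End ℂ (A ⊗[ℂ] A)) (z : A ⊗[ℂ] A) :
    flipConj f z = TensorProduct.comm ℂ A A (f (TensorProduct.comm ℂ A A z)) := rfl

@[simp] theorem comm_comm (z : A ⊗[ℂ] A) :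
    TensorProduct.comm ℂ A A (TensorProduct.comm ℂ A A z) = z :=
  (TensorProduct.comm ℂ A A).symm_apply_apply z

theorem flipConj_flipConj (f : Module.End ℂ (A ⊗[ℂ] A)) : flipConj (flipConj f) = f := by
  ext; simp

variable (A) in
/-- Reversal of the three legs. -/
def rev : A ⊗[ℂ] (A ⊗[ℂ] A) ≃ₗ[ℂ] A ⊗[ℂ] (A ⊗[ℂ] A) :=
  (TensorProduct.comm ℂ A (A ⊗[ℂ] A)).trans
    ((TensorProduct.congr (TensorProduct.comm ℂ A A) (LinearEquiv.refl ℂ A)).trans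
      (TensorProduct.assoc ℂ A A A))

@[simp] theorem rev_tmul (a b c : A) : rev A (a ⊗ₜ (b ⊗ₜ c)) = c ⊗ₜ (b ⊗ₜ a) := by
  simp [rev]

theorem rev_tmul' (a : A) (z : A ⊗[ℂ] A) :
    rev A (a ⊗ₜ z) = TensorProduct.assoc ℂ A A A (TensorProduct.comm ℂ A A z ⊗ₜ a) := by
  simp [rev]

theorem rev_assoc (c : A) (z : A ⊗[ℂ] A) :
    rev A (TensorProduct.assoc ℂ A A A (z ⊗ₜ c)) = c ⊗ₜ TensorProduct.comm ℂ A A z := by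
  induction z with
  | zero => simp
  | add x y hx hy => simp only [TensorProduct.add_tmul, TensorProduct.tmul_add, map_add, hx, hy]
  | tmul x a => simp

theorem rev_opL (f : Module.End ℂ (A ⊗[ℂ] A)) (w : A ⊗[ℂ] (A ⊗[ℂ] A)) :
    rev A (opL A f w) = (flipConj f).lTensor A (rev A w) := by
  have : (rev A).toLinearMap ∘ₗ opL A f = (flipConj f).lTensor A ∘ₗ (rev A).toLinearMap := by
    ext a b c
    simp [rev_assoc]
  exact LinearMap.congr_fun this w

theorem rev_lTensor (f : Module.End ℂ (A ⊗[ℂ] A)) (w : A ⊗[ℂ] (A ⊗[ℂ] A)) :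
    rev A (f.lTensor A w) = opL A (flipConj f) (rev A w) := by
  have : (rev A).toLinearMap ∘ₗ f.lTensor A = opL A (flipConj f) ∘ₗ (rev A).toLinearMap := by
    ext a b c
    simp [rev_tmul']
  exact LinearMap.congr_fun this w

/-- Reversing the three legs exchanges the two places. This carries results about `T₁` over to `T₂`,
and results about `K` over to `H`. -/
theorem LegComm.flipConj {f g : Module.End ℂ (A ⊗[ℂ] A)} (h : LegComm f g) :
    LegComm (flipConj g) (flipConj f) := by
  apply LinearMap.ext
  intro w
  obtain ⟨w, rfl⟩ := (rev A).surjective w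
  have := congrArg (rev A) (LinearMap.congr_fun h.eq w)
  simp only [Module.End.mul_apply, rev_opL, rev_lTensor] at this ⊢
  exact this.symm

theorem LegComm.of_flipConj {f g : Module.End ℂ (A ⊗[ℂ] A)}
    (h : LegComm (_root_.flipConj g) (_root_.flipConj f)) : LegComm f g := by
  simpa only [flipConj_flipConj] using h.flipConj

end LegOperators

/-! ### The projection attached to a canonical map -/

section CanonicalProjection

variable {A : Type*} [AddCommGroup A] [Module ℂ A]

/-- `T` is a canonical map with full left leg, `P` a projection on its range, and `G` is the
operator with `(G ⊗ ι)T₁₃ = T₁₃P₂₃` whose complement is the projection on the kernel of `T`. -/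
structure IsCanonicalMap (T P G : Module.End ℂ (A ⊗[ℂ] A)) : Prop where
  full : ∀ V : Submodule ℂ A, LinearMap.range T ≤
    LinearMap.range (TensorProduct.map V.subtype (LinearMap.id : A →ₗ[ℂ] A)) → V = ⊤
  idem : P * P = P
  range_eq : LinearMap.range P = LinearMap.range T
  spec : ∀ a b c, TensorProduct.map G LinearMap.id (delta₁₃Right T (a ⊗ₜ (b ⊗ₜ c))) =
    delta₁₃Right T (a ⊗ₜ P (b ⊗ₜ c))
  ker_eq : LinearMap.ker T = LinearMap.range (LinearMap.id - G)

/-- `a ⊗ (b ⊗ c) ↦ (ι ⊗ ω)(T(a ⊗ c)) ⊗ b`. -/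
def sliceDelta (T : Module.End ℂ (A ⊗[ℂ] A)) (ω : A →ₗ[ℂ] ℂ) :
    A ⊗[ℂ] (A ⊗[ℂ] A) →ₗ[ℂ] A ⊗[ℂ] A :=
  slR ω ∘ₗ delta₁₃Right T

@[simp] theorem sliceDelta_tmul (T : Module.End ℂ (A ⊗[ℂ] A)) (ω : A →ₗ[ℂ] ℂ) (a b c : A) :
    sliceDelta T ω (a ⊗ₜ (b ⊗ₜ c)) = slR ω (T (a ⊗ₜ c)) ⊗ₜ b := by
  simp only [sliceDelta, delta₁₃Right, LinearMap.comp_apply, LinearEquiv.coe_coe,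
    TensorProduct.leftComm_tmul, TensorProduct.map_tmul, LinearMap.id_apply]
  induction T (a ⊗ₜ c) with
  | zero => simp
  | add x y hx hy => simp only [TensorProduct.add_tmul, TensorProduct.tmul_add, map_add, hx, hy]
  | tmul x y => simp [TensorProduct.smul_tmul']

/-- Over a field the kernel of k ⊗ ι is ker k ⊗ A. Hence the range of T lies in ker k ⊗ A, and
fullness gives ker k = A. -/
theorem eq_zero_of_full {T : Module.End ℂ (A ⊗[ℂ] A)}
    (full : ∀ V : Submodule ℂ A, LinearMap.range T ≤
      LinearMap.range (TensorProduct.map V.subtype (LinearMap.id : A →ₗ[ℂ] A)) → V = ⊤)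
    {V : Type*} [AddCommGroup V] [Module ℂ V] (k : A →ₗ[ℂ] V)
    (hk : ∀ a c, k.rTensor A (T (a ⊗ₜ c)) = 0) : k = 0 := by
  rw [← LinearMap.ker_eq_top]
  apply full
  have hk' : k.rTensor A ∘ₗ T = 0 := by ext a c; simpa using hk a c
  rintro _ ⟨w, rfl⟩
  have hex := Module.Flat.rTensor_exact A (LinearMap.exact_subtype_ker_map k)
  exact (hex (T w)).1 (LinearMap.congr_fun hk' w)

namespace IsCanonicalMap

variable {T P G : Module.End ℂ (A ⊗[ℂ] A)} (h : IsCanonicalMap T P G)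
include h

theorem proj_sliceDelta (ω : A →ₗ[ℂ] ℂ) (w : A ⊗[ℂ] (A ⊗[ℂ] A)) :
    G (sliceDelta T ω w) = sliceDelta T ω (P.lTensor A w) := by
  have : G ∘ₗ sliceDelta T ω = sliceDelta T ω ∘ₗ P.lTensor A := by
    ext a b c
    have := congrArg (slR ω) (h.spec a b c)
    rw [show TensorProduct.map G LinearMap.id = G.rTensor A from rfl, slR_rTensor] at this
    exact this
  exact LinearMap.congr_fun this w

/-- By fullness the elements (ι ⊗ ω)T(a ⊗ c) span A, so the slices of T₁₃ span A ⊗ A. -/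
theorem ext_sliceDelta {V : Type*} [AddCommGroup V] [Module ℂ V] {k k' : A ⊗[ℂ] A →ₗ[ℂ] V}
    (hk : ∀ ω w, k (sliceDelta T ω w) = k' (sliceDelta T ω w)) : k = k' := by
  rw [← sub_eq_zero]
  suffices hs : ∀ b, (k - k') ∘ₗ (TensorProduct.mk ℂ A A).flip b = 0 from
    TensorProduct.ext' fun a b => LinearMap.congr_fun (hs b) a
  intro b
  refine eq_zero_of_full h.full _ fun a c => eq_zero_of_slR _ fun ω => ?_
  rw [slR_rTensor]
  have := hk ω (a ⊗ₜ (b ⊗ₜ c))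
  rw [sliceDelta_tmul] at this
  simp [this]

/-- On slices of T₁₃, which span, G acts as P on the last two arguments, so it inherits idempotency
from P. -/
theorem proj_mul_proj : G * G = G := by
  refine h.ext_sliceDelta fun ω w => ?_
  rw [Module.End.mul_apply, h.proj_sliceDelta, h.proj_sliceDelta]
  congr 1
  conv_rhs => rw [← h.idem, LinearMap.lTensor_mul]
  rfl

theorem exists_genInv : ∃ R, IsGenInv T P G R :=
  exists_isGenInv h.idem h.range_eq h.proj_mul_proj h.ker_eq

/-- Write the argument of G as a slice of T₁₃ at a ⊗ b ⊗ c, with x as a fourth leg in front. There f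
acts on (x, a) and passes through the slice because it commutes with T, while G becomes P acting on
(b, c), which f does not touch. -/
theorem legComm_proj {f : Module.End ℂ (A ⊗[ℂ] A)} (hf : LegComm f T) : LegComm f G := by
  have hslice : ∀ ω (w : A ⊗[ℂ] (A ⊗[ℂ] (A ⊗[ℂ] A))),
      opL A f ((sliceDelta T ω).lTensor A w) =
        (sliceDelta T ω).lTensor A (opL (A ⊗[ℂ] A) f w) := by
    intro ω w
    have : opL A f ∘ₗ (sliceDelta T ω).lTensor A =
        (sliceDelta T ω).lTensor A ∘ₗ opL (A ⊗[ℂ] A) f := by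
      ext x a b c
      have h1 := congrArg ((slR ω).lTensor A) (hf.apply x (a ⊗ₜ c))
      have h2 : ∀ z : A ⊗[ℂ] A, (slR ω).lTensor A (opL A f (x ⊗ₜ z)) = f (x ⊗ₜ slR ω z) := by
        intro z
        induction z with
        | zero => simp
        | add z z' hz hz' => simp only [TensorProduct.tmul_add, map_add, hz, hz']
        | tmul p q =>
          rw [opL_tmul, slR_tmul, TensorProduct.tmul_smul, map_smul]
          induction f (x ⊗ₜ p) with
          | zero => simp
          | add z z' hz hz' => simp only [TensorProduct.add_tmul, map_add, smul_add, hz, hz']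
          | tmul r s => simp
      rw [h2, opL_tmul] at h1
      simp only [LinearMap.comp_apply, TensorProduct.AlgebraTensorModule.curry_apply,
        TensorProduct.curry_apply, LinearMap.lTensor_tmul, LinearMap.coe_restrictScalars,
        sliceDelta_tmul, opL_tmul, h1]
      induction f (x ⊗ₜ a) with
      | zero => simp
      | add z z' hz hz' => simp only [TensorProduct.add_tmul, map_add, hz, hz']
      | tmul r s => simp
    exact LinearMap.congr_fun this w
  apply TensorProduct.ext'
  intro x
  suffices hs : (opL A f * G.lTensor A) ∘ₗ TensorProduct.mk ℂ A _ x =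
      (G.lTensor A * opL A f) ∘ₗ TensorProduct.mk ℂ A _ x from fun z => LinearMap.congr_fun hs z
  refine h.ext_sliceDelta fun ω w => ?_
  have e1 : x ⊗ₜ[ℂ] sliceDelta T ω w = (sliceDelta T ω).lTensor A (x ⊗ₜ w) := by simp
  have e2 : ∀ w' : A ⊗[ℂ] (A ⊗[ℂ] (A ⊗[ℂ] A)), G.lTensor A ((sliceDelta T ω).lTensor A w') =
      (sliceDelta T ω).lTensor A ((P.lTensor A).lTensor A w') := by
    intro w'
    rw [← LinearMap.lTensor_comp_apply, ← LinearMap.lTensor_comp_apply]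
    congr 2
    refine LinearMap.ext fun u => ?_
    exact h.proj_sliceDelta ω u
  simp only [LinearMap.comp_apply, TensorProduct.mk_apply, Module.End.mul_apply]
  rw [e1, e2, hslice, hslice, e2, opL_lTensor_lTensor]

end IsCanonicalMap

end CanonicalProjection

/-! ### Multipliers of tensor products -/

section MultiplierLemmas

variable {A : Type*} [NonUnitalRing A] [Module ℂ A] [IsScalarTower ℂ A A] [SMulCommClass ℂ A A]
variable {B : Type*} [NonUnitalRing B] [Module ℂ B] [IsScalarTower ℂ B B] [SMulCommClass ℂ B B]

namespace MultAlg

@[simp] theorem mul_l (m n : MultAlg A) (a : A) : (m * n).l a = m.l (n.l a) := rfl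

@[simp] theorem mul_r (m n : MultAlg A) (a : A) : (m * n).r a = n.r (m.r a) := rfl

@[simp] theorem one_l (a : A) : (1 : MultAlg A).l a = a := rfl

@[simp] theorem one_r (a : A) : (1 : MultAlg A).r a = a := rfl

@[simp] theorem add_l (m n : MultAlg A) (a : A) : (m + n).l a = m.l a + n.l a := rfl

@[simp] theorem add_r (m n : MultAlg A) (a : A) : (m + n).r a = m.r a + n.r a := rfl

@[simp] theorem smul_l (c : ℂ) (m : MultAlg A) (a : A) : (c • m).l a = c • m.l a := rfl

@[simp] theorem smul_r (c : ℂ) (m : MultAlg A) (a : A) : (c • m).r a = c • m.r a := rfl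

@[simp] theorem mk_l (f g : A →ₗ[ℂ] A) (h₁ h₂ h₃) : (mk f g h₁ h₂ h₃).l = f := rfl

@[simp] theorem mk_r (f g : A →ₗ[ℂ] A) (h₁ h₂ h₃) : (mk f g h₁ h₂ h₃).r = g := rfl

@[simp] theorem incl_l (a b : A) : (incl a).l b = a * b := rfl

@[simp] theorem incl_r (a b : A) : (incl a).r b = b * a := rfl

theorem tmul_l (m : MultAlg A) (n : MultAlg B) : (tmul m n).l = TensorProduct.map m.l n.l := rfl

theorem tmul_r (m : MultAlg A) (n : MultAlg B) : (tmul m n).r = TensorProduct.map m.r n.r := rfl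

theorem ext_of_l_of_r {m n : MultAlg A} (hl : ∀ a, m.l a = n.l a) (hr : ∀ a, m.r a = n.r a) :
    m = n :=
  Subtype.ext (Prod.ext (LinearMap.ext hl) (MulOpposite.unop_injective (LinearMap.ext hr)))

theorem ext_of_l (hA : NondegenerateProduct A) {m n : MultAlg A} (h : ∀ a, m.l a = n.l a) :
    m = n := by
  refine ext_of_l_of_r h fun a => ?_
  rw [← sub_eq_zero]
  refine hA.1 _ fun b => ?_
  rw [sub_mul, r_mul_eq, r_mul_eq, h, sub_self]

theorem ext_of_r (hA : NondegenerateProduct A) {m n : MultAlg A} (h : ∀ a, m.r a = n.r a) :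
    m = n := by
  refine ext_of_l_of_r (fun a => ?_) h
  rw [← sub_eq_zero]
  refine hA.2 _ fun b => ?_
  rw [mul_sub, ← r_mul_eq, ← r_mul_eq, h, sub_self]

theorem incl_injective (hA : NondegenerateProduct A) : Function.Injective (incl : A → MultAlg A) := by
  intro a b h
  rw [← sub_eq_zero]
  refine hA.1 _ fun c => ?_
  have := congrArg (fun m : MultAlg A => m.l c) h
  simpa [sub_mul, sub_eq_zero] using this

theorem incl_mul_eq (a : A) (m : MultAlg A) : incl a * m = incl (m.r a) :=
  ext_of_l_of_r (fun b => by simp [r_mul_eq]) (fun b => by simp [r_mul])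

theorem mul_incl_eq (a : A) (m : MultAlg A) : m * incl a = incl (m.l a) :=
  ext_of_l_of_r (fun b => by simp [l_mul]) (fun b => by simp [r_mul_eq])

/-- The associativity (ma)n = m(an) is checked after multiplying by b on the right; this is where
non-degeneracy enters. -/
theorem l_r_comm (hA : NondegenerateProduct A) (m n : MultAlg A) (a : A) :
    m.l (n.r a) = n.r (m.l a) := by
  rw [← sub_eq_zero]
  refine hA.1 _ fun b => ?_
  rw [sub_mul, ← l_mul, r_mul_eq, r_mul_eq, l_mul, sub_self]

/-- The flip of a multiplier of `A ⊗ A`. -/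
def swap (m : MultAlg (A ⊗[ℂ] A)) : MultAlg (A ⊗[ℂ] A) :=
  transport (TensorProduct.comm ℂ A A) (fun x y => by
    induction x with
    | zero => simp
    | add x x' hx hx' => simp [add_mul, hx, hx']
    | tmul a b =>
      induction y with
      | zero => simp
      | add y y' hy hy' => simp only [mul_add, map_add, hy, hy']
      | tmul a' b' => simp) m

theorem swap_l (m : MultAlg (A ⊗[ℂ] A)) : m.swap.l = flipConj m.l := rfl

theorem swap_r (m : MultAlg (A ⊗[ℂ] A)) : m.swap.r = flipConj m.r := rfl

theorem swap_swap (m : MultAlg (A ⊗[ℂ] A)) : m.swap.swap = m :=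
  ext_of_l_of_r (fun a => by simp [swap_l, flipConj_flipConj])
    (fun a => by simp [swap_r, flipConj_flipConj])

theorem swap_mul (m n : MultAlg (A ⊗[ℂ] A)) : (m * n).swap = m.swap * n.swap :=
  ext_of_l_of_r (fun a => by simp [swap_l, flipConj_apply])
    (fun a => by simp [swap_r, flipConj_apply])

end MultAlg

/-! ### One-legged multiplications on `A ⊗ V` and `V ⊗ A` -/

variable {V : Type*} [AddCommGroup V] [Module ℂ V]

/-- `z ↦ (c ⊗ 1)z`. -/
abbrev lm₁ (c : A) : A ⊗[ℂ] V →ₗ[ℂ] A ⊗[ℂ] V := (LinearMap.mulLeft ℂ c).rTensor V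

/-- `z ↦ (1 ⊗ c)z`. -/
abbrev lm₂ (c : A) : V ⊗[ℂ] A →ₗ[ℂ] V ⊗[ℂ] A := (LinearMap.mulLeft ℂ c).lTensor V

/-- `z ↦ z(c ⊗ 1)`. -/
abbrev rm₁ (c : A) : A ⊗[ℂ] V →ₗ[ℂ] A ⊗[ℂ] V := (LinearMap.mulRight ℂ c).rTensor V

/-- `z ↦ z(1 ⊗ c)`. -/
abbrev rm₂ (c : A) : V ⊗[ℂ] A →ₗ[ℂ] V ⊗[ℂ] A := (LinearMap.mulRight ℂ c).lTensor V

theorem eq_of_lm₁ (hA : NondegenerateProduct A) {z z' : A ⊗[ℂ] V}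
    (h : ∀ c, lm₁ c z = lm₁ c z') : z = z' :=
  eq_of_rTensor (fun c : A => LinearMap.mulLeft ℂ c) (fun v hv => hA.2 v hv) h

theorem eq_of_rm₁ (hA : NondegenerateProduct A) {z z' : A ⊗[ℂ] V}
    (h : ∀ c, rm₁ c z = rm₁ c z') : z = z' :=
  eq_of_rTensor (fun c : A => LinearMap.mulRight ℂ c) (fun v hv => hA.1 v hv) h

theorem eq_of_lm₂ (hA : NondegenerateProduct A) {z z' : V ⊗[ℂ] A}
    (h : ∀ c, lm₂ c z = lm₂ c z') : z = z' :=
  eq_of_lTensor (fun c : A => LinearMap.mulLeft ℂ c) (fun v hv => hA.2 v hv) h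

theorem eq_of_rm₂ (hA : NondegenerateProduct A) {z z' : V ⊗[ℂ] A}
    (h : ∀ c, rm₂ c z = rm₂ c z') : z = z' :=
  eq_of_lTensor (fun c : A => LinearMap.mulRight ℂ c) (fun v hv => hA.1 v hv) h

theorem mul_tmul_eq (z : A ⊗[ℂ] B) (x : A) (y : B) : z * (x ⊗ₜ y) = rm₁ x (rm₂ y z) := by
  induction z with
  | zero => simp
  | add z z' hz hz' => simp only [add_mul, map_add, hz, hz']
  | tmul a b => simp

theorem tmul_mul_eq (z : A ⊗[ℂ] B) (x : A) (y : B) : (x ⊗ₜ y) * z = lm₁ x (lm₂ y z) := by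
  induction z with
  | zero => simp
  | add z z' hz hz' => simp only [mul_add, map_add, hz, hz']
  | tmul a b => simp

theorem NondegenerateProduct.tensor (hA : NondegenerateProduct A) (hB : NondegenerateProduct B) :
    NondegenerateProduct (A ⊗[ℂ] B) := by
  refine ⟨fun z hz => ?_, fun z hz => ?_⟩
  · refine eq_of_rm₂ hB fun y => eq_of_rm₁ hA fun x => ?_
    rw [← mul_tmul_eq, hz]; simp
  · refine eq_of_lm₂ hB fun y => eq_of_lm₁ hA fun x => ?_
    rw [← tmul_mul_eq, hz]; simp

theorem eq_of_mul_right (hA : NondegenerateProduct A) {z z' : A} (h : ∀ w, z * w = z' * w) :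
    z = z' := by
  rw [← sub_eq_zero]
  exact hA.1 _ fun w => by rw [sub_mul, h, sub_self]

theorem eq_of_mul_left (hA : NondegenerateProduct A) {z z' : A} (h : ∀ w, w * z = w * z') :
    z = z' := by
  rw [← sub_eq_zero]
  exact hA.2 _ fun w => by rw [mul_sub, h, sub_self]

theorem tmul_one_incl_l (c : B) : (tmul (1 : MultAlg A) (incl c)).l = lm₂ c := rfl

theorem lm₁_mul (c : A) (z w : A ⊗[ℂ] B) : lm₁ c z * w = lm₁ c (z * w) :=
  ((tmul (incl c) (1 : MultAlg B)).l_mul z w).symm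

theorem lm₂_mul (c : B) (z w : A ⊗[ℂ] B) : lm₂ c z * w = lm₂ c (z * w) :=
  ((tmul (1 : MultAlg A) (incl c)).l_mul z w).symm

theorem rm₁_mul (c : A) (z w : A ⊗[ℂ] B) : rm₁ c z * w = z * lm₁ c w :=
  (tmul (incl c) (1 : MultAlg B)).r_mul_eq z w

theorem rm₂_mul (c : B) (z w : A ⊗[ℂ] B) : rm₂ c z * w = z * lm₂ c w :=
  (tmul (1 : MultAlg A) (incl c)).r_mul_eq z w

theorem lm₁_lm₁ (c d : A) (z : A ⊗[ℂ] V) : lm₁ c (lm₁ d z) = lm₁ (c * d) z := by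
  rw [← LinearMap.rTensor_comp_apply]
  congr 2
  ext
  simp

theorem comm_lm₁ (c : A) (z : A ⊗[ℂ] A) :
    TensorProduct.comm ℂ A A (lm₁ c z) = lm₂ c (TensorProduct.comm ℂ A A z) := by
  induction z with
  | zero => simp
  | add z z' hz hz' => simp only [map_add, hz, hz']
  | tmul a b => simp

theorem comm_lm₂ (c : A) (z : A ⊗[ℂ] A) :
    TensorProduct.comm ℂ A A (lm₂ c z) = lm₁ c (TensorProduct.comm ℂ A A z) := by
  induction z with
  | zero => simp
  | add z z' hz hz' => simp only [map_add, hz, hz']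
  | tmul a b => simp

theorem comm_rm₁ (c : A) (z : A ⊗[ℂ] A) :
    TensorProduct.comm ℂ A A (rm₁ c z) = rm₂ c (TensorProduct.comm ℂ A A z) := by
  induction z with
  | zero => simp
  | add z z' hz hz' => simp only [map_add, hz, hz']
  | tmul a b => simp

theorem comm_rm₂ (c : A) (z : A ⊗[ℂ] A) :
    TensorProduct.comm ℂ A A (rm₂ c z) = rm₁ c (TensorProduct.comm ℂ A A z) := by
  induction z with
  | zero => simp
  | add z z' hz hz' => simp only [map_add, hz, hz']
  | tmul a b => simp

theorem comm_mul (z w : A ⊗[ℂ] A) : TensorProduct.comm ℂ A A (z * w) =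
    TensorProduct.comm ℂ A A z * TensorProduct.comm ℂ A A w := by
  induction w with
  | zero => simp
  | add w w' hw hw' => simp only [mul_add, map_add, hw, hw']
  | tmul a b =>
    rw [mul_tmul_eq, comm_rm₁, comm_rm₂, TensorProduct.comm_tmul, mul_tmul_eq]
    simp only [rm₁, rm₂]
    exact LinearMap.congr_fun ((LinearMap.lTensor_comp_rTensor _ _ _).trans
      (LinearMap.rTensor_comp_lTensor _ _ _).symm) _

end MultiplierLemmas

/-! ### Canonical maps, the canonical idempotent and the counit -/

namespace WeakMultiplierHopfAlgebra

variable {A : Type*} [NonUnitalRing A] [Module ℂ A] [IsScalarTower ℂ A A] [SMulCommClass ℂ A A]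

section Basic

variable (H : WeakMultiplierHopfAlgebra A)

include H in
theorem nondegenerate₂ : NondegenerateProduct (A ⊗[ℂ] A) := H.nondegenerate.tensor H.nondegenerate

theorem T₁_mul (a b : A) (w : A ⊗[ℂ] A) : H.T₁ (a ⊗ₜ b) * w = (H.Δ a).l (lm₂ b w) :=
  congrArg (fun m => m.l w) (H.T₁_spec a b)

theorem T₂_mul (a b : A) (w : A ⊗[ℂ] A) : H.T₂ (a ⊗ₜ b) * w = lm₁ a ((H.Δ b).l w) :=
  congrArg (fun m => m.l w) (H.T₂_spec a b)

theorem mul_T₂ (a b : A) (w : A ⊗[ℂ] A) : w * H.T₂ (a ⊗ₜ b) = (H.Δ b).r (rm₁ a w) :=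
  congrArg (fun m => m.r w) (H.T₂_spec a b)

theorem Δ_l_tmul (a x y : A) : (H.Δ a).l (x ⊗ₜ y) = rm₁ x (H.T₁ (a ⊗ₜ y)) := by
  refine eq_of_mul_right H.nondegenerate₂ fun w => ?_
  rw [rm₁_mul, H.T₁_mul, ← l_mul, tmul_mul_eq]
  congr 1
  exact LinearMap.congr_fun ((LinearMap.rTensor_comp_lTensor _ _ _).trans
    (LinearMap.lTensor_comp_rTensor _ _ _).symm) _

theorem Δ_r_tmul (a x y : A) : (H.Δ a).r (x ⊗ₜ y) = lm₂ y (H.T₂ (x ⊗ₜ a)) := by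
  refine eq_of_mul_right H.nondegenerate₂ fun w => ?_
  rw [lm₂_mul, H.T₂_mul, r_mul_eq, tmul_mul_eq]
  exact LinearMap.congr_fun ((LinearMap.rTensor_comp_lTensor _ _ _).trans
    (LinearMap.lTensor_comp_rTensor _ _ _).symm) _

theorem Δ_l_T₁ (a b c : A) : (H.Δ a).l (H.T₁ (b ⊗ₜ c)) = H.T₁ ((a * b) ⊗ₜ c) := by
  refine eq_of_mul_right H.nondegenerate₂ fun w => ?_
  rw [← l_mul, H.T₁_mul, H.T₁_mul, map_mul, mul_l]

theorem Δ_r_T₂ (a b c : A) : (H.Δ c).r (H.T₂ (a ⊗ₜ b)) = H.T₂ (a ⊗ₜ (b * c)) := by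
  refine eq_of_mul_left H.nondegenerate₂ fun w => ?_
  rw [← r_mul, H.mul_T₂, H.mul_T₂, map_mul, mul_r]

theorem rm₂_T₁ (a b c : A) : rm₂ c (H.T₁ (a ⊗ₜ b)) = H.T₁ (a ⊗ₜ (b * c)) := by
  refine eq_of_mul_right H.nondegenerate₂ fun w => ?_
  rw [rm₂_mul, H.T₁_mul, H.T₁_mul]
  congr 1
  rw [← LinearMap.lTensor_comp_apply]
  congr 2
  ext
  simp

theorem lm₁_T₁ (a b c : A) : lm₁ c (H.T₁ (a ⊗ₜ b)) = rm₂ b (H.T₂ (c ⊗ₜ a)) := by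
  refine eq_of_mul_right H.nondegenerate₂ fun w => ?_
  rw [lm₁_mul, rm₂_mul, H.T₁_mul, H.T₂_mul]

theorem E_l_idem (z : A ⊗[ℂ] A) : H.E.l (H.E.l z) = H.E.l z :=
  congrArg (fun m => m.l z) H.E_idempotent

theorem E_r_idem (z : A ⊗[ℂ] A) : H.E.r (H.E.r z) = H.E.r z :=
  congrArg (fun m => m.r z) H.E_idempotent

theorem E_l_T₁ (z : A ⊗[ℂ] A) : H.E.l (H.T₁ z) = H.T₁ z := by
  have : H.T₁ z ∈ LinearMap.range H.E.l := H.range_T₁ ▸ LinearMap.mem_range_self _ z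
  obtain ⟨w, hw⟩ := this
  rw [← hw, E_l_idem]

theorem E_r_T₂ (z : A ⊗[ℂ] A) : H.E.r (H.T₂ z) = H.T₂ z := by
  have : H.T₂ z ∈ LinearMap.range H.E.r := H.range_T₂ ▸ LinearMap.mem_range_self _ z
  obtain ⟨w, hw⟩ := this
  rw [← hw, E_r_idem]

theorem exists_T₁_eq (z : A ⊗[ℂ] A) : ∃ w, H.T₁ w = H.E.l z := by
  have : H.E.l z ∈ LinearMap.range H.T₁ := H.range_T₁ ▸ LinearMap.mem_range_self _ z
  exact this

theorem exists_T₂_eq (z : A ⊗[ℂ] A) : ∃ w, H.T₂ w = H.E.r z := by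
  have : H.E.r z ∈ LinearMap.range H.T₂ := H.range_T₂ ▸ LinearMap.mem_range_self _ z
  exact this

include H in
theorem l_rm₁ (m : MultAlg (A ⊗[ℂ] A)) (c : A) (z : A ⊗[ℂ] A) : m.l (rm₁ c z) = rm₁ c (m.l z) :=
  l_r_comm H.nondegenerate₂ m (tmul (incl c) 1) z

include H in
theorem l_rm₂ (m : MultAlg (A ⊗[ℂ] A)) (c : A) (z : A ⊗[ℂ] A) : m.l (rm₂ c z) = rm₂ c (m.l z) :=
  l_r_comm H.nondegenerate₂ m (tmul 1 (incl c)) z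

include H in
theorem r_lm₂ (m : MultAlg (A ⊗[ℂ] A)) (c : A) (z : A ⊗[ℂ] A) : m.r (lm₂ c z) = lm₂ c (m.r z) :=
  (l_r_comm H.nondegenerate₂ (tmul 1 (incl c)) m z).symm

/-- Δ(a)(x ⊗ y) = T₁(a ⊗ y)(x ⊗ 1), and E fixes the range of `T₁`. -/
theorem E_mul_Δ (a : A) : H.E * H.Δ a = H.Δ a := by
  refine ext_of_l H.nondegenerate₂ fun z => ?_
  induction z with
  | zero => simp
  | add z z' hz hz' => simp only [map_add, hz, hz']
  | tmul x y => rw [mul_l, H.Δ_l_tmul, H.l_rm₁, H.E_l_T₁]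

theorem Δ_mul_E (a : A) : H.Δ a * H.E = H.Δ a := by
  refine ext_of_r H.nondegenerate₂ fun z => ?_
  induction z with
  | zero => simp
  | add z z' hz hz' => simp only [map_add, hz, hz']
  | tmul x y => rw [mul_r, H.Δ_r_tmul, H.r_lm₂, H.E_r_T₂]

theorem Δ_l_E_l (a : A) (z : A ⊗[ℂ] A) : (H.Δ a).l (H.E.l z) = (H.Δ a).l z :=
  congrArg (fun m => m.l z) (H.Δ_mul_E a)

theorem Δ_r_E_r (a : A) (z : A ⊗[ℂ] A) : (H.Δ a).r (H.E.r z) = (H.Δ a).r z :=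
  congrArg (fun m => m.r z) (H.E_mul_Δ a)

theorem slL_T₁ (a b : A) : slL H.ε (H.T₁ (a ⊗ₜ b)) = a * b := H.counit_left a b

theorem slR_T₂ (a b : A) : slR H.ε (H.T₂ (a ⊗ₜ b)) = a * b := H.counit_right a b

theorem slL_T₁' (z : A ⊗[ℂ] A) : slL H.ε (H.T₁ z) = LinearMap.mul' ℂ A z := by
  have : slL H.ε ∘ₗ H.T₁ = LinearMap.mul' ℂ A := by ext a b; simp [H.slL_T₁]
  exact LinearMap.congr_fun this z

theorem slR_T₂' (z : A ⊗[ℂ] A) : slR H.ε (H.T₂ z) = LinearMap.mul' ℂ A z := by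
  have : slR H.ε ∘ₗ H.T₂ = LinearMap.mul' ℂ A := by ext a b; simp [H.slR_T₂]
  exact LinearMap.congr_fun this z

end Basic

/-- `K` has the opposite coproduct of `H`. -/
def IsCop (H K : WeakMultiplierHopfAlgebra A) : Prop := ∀ a, K.Δ a = (H.Δ a).swap

/-! ### Comparison with the co-opposite algebra -/

section Cop

variable {H K : WeakMultiplierHopfAlgebra A} (h : IsCop H K)
include h

theorem IsCop.symm : IsCop K H := fun a => by rw [h a, swap_swap]

/-- The range of `K.E` is that of `K.T₁`, and there the flip of E acts trivially since EΔ(a) = Δ(a).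
-/
theorem IsCop.swap_E_mul_E : H.E.swap * K.E = K.E := by
  refine ext_of_l K.nondegenerate₂ fun z => ?_
  obtain ⟨w, hw⟩ := K.exists_T₁_eq z
  rw [mul_l, ← hw]
  clear hw z
  induction w with
  | zero => simp
  | add w w' hw hw' => simp only [map_add, hw, hw']
  | tmul a b =>
    refine eq_of_mul_right K.nondegenerate₂ fun v => ?_
    rw [← l_mul, K.T₁_mul, h a]
    exact congrArg (fun m : MultAlg (A ⊗[ℂ] A) => m.l _)
      ((swap_mul H.E (H.Δ a)).symm.trans (congrArg swap (H.E_mul_Δ a)))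

theorem IsCop.E_mul_swap_E : K.E * H.E.swap = K.E := by
  refine ext_of_r K.nondegenerate₂ fun z => ?_
  obtain ⟨w, hw⟩ := K.exists_T₂_eq z
  rw [mul_r, ← hw]
  clear hw z
  induction w with
  | zero => simp
  | add w w' hw hw' => simp only [map_add, hw, hw']
  | tmul a b =>
    refine eq_of_mul_left K.nondegenerate₂ fun v => ?_
    rw [← r_mul, K.mul_T₂, h b]
    exact congrArg (fun m : MultAlg (A ⊗[ℂ] A) => m.r _)
      ((swap_mul (H.Δ b) H.E).symm.trans (congrArg swap (H.Δ_mul_E b)))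

/-- The product of `K.E` with the flip of `H.E` equals each of its factors, by absorption in either
direction. -/
theorem IsCop.E_eq : K.E = H.E.swap := by
  have h1 := h.E_mul_swap_E
  have h2 := congrArg swap h.symm.swap_E_mul_E
  rw [swap_mul, swap_swap] at h2
  rw [← h1, h2]

/-- `(c ⊗ 1)·flip(K.T₁(a ⊗ b)) = T₂(c ⊗ a)(b ⊗ 1)`. -/
theorem IsCop.lm₂_T₁ (a b c : A) :
    lm₂ c (K.T₁ (a ⊗ₜ b)) = rm₂ b (TensorProduct.comm ℂ A A (H.T₂ (c ⊗ₜ a))) := by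
  refine eq_of_mul_right K.nondegenerate₂ fun w => ?_
  rw [lm₂_mul, rm₂_mul, K.T₁_mul, h a, swap_l, flipConj_apply, ← comm_lm₁, ← H.T₂_mul, comm_mul,
    comm_comm]

/-- `K.ε` satisfies the right counit identity of `H` too, and fullness of the right leg leaves only
one such functional. -/
theorem IsCop.ε_eq : K.ε = H.ε := by
  have key : ∀ c a, slR K.ε (H.T₂ (c ⊗ₜ a)) = c * a := by
    intro c a
    refine eq_of_mul_right H.nondegenerate fun b => ?_
    have h1 := congrArg (slL K.ε) (h.lm₂_T₁ a b c)
    rw [slL_lTensor, slL_lTensor, K.slL_T₁, slL_comm] at h1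
    simpa [mul_assoc] using h1.symm
  have hflip : ∀ c a, (K.ε - H.ε).lTensor A (H.T₂ (c ⊗ₜ a)) = 0 := by
    intro c a
    apply (TensorProduct.rid ℂ A).injective
    change slR (K.ε - H.ε) _ = _
    have : (slR (K.ε - H.ε) : A ⊗[ℂ] A →ₗ[ℂ] A) = slR K.ε - slR H.ε := by ext; simp [sub_smul]
    rw [this, LinearMap.sub_apply, key, H.slR_T₂]
    simp
  rw [← sub_eq_zero, ← LinearMap.ker_eq_top]
  apply H.full_right
  have hk' : (K.ε - H.ε).lTensor A ∘ₗ H.T₂ = 0 := by ext a c; simpa using hflip a c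
  rintro _ ⟨w, rfl⟩
  have hex := Module.Flat.lTensor_exact A (LinearMap.exact_subtype_ker_map (K.ε - H.ε))
  exact (hex (H.T₂ w)).1 (LinearMap.congr_fun hk' w)

end Cop

end WeakMultiplierHopfAlgebra

/-! ### Commutation of the canonical maps on neighbouring legs -/

section TensorMultipliers

variable {A : Type*} [NonUnitalRing A] [Module ℂ A] [IsScalarTower ℂ A A] [SMulCommClass ℂ A A]
variable {B : Type*} [NonUnitalRing B] [Module ℂ B] [IsScalarTower ℂ B B] [SMulCommClass ℂ B B]

namespace MultAlg

theorem incl_add (a b : A) : incl (a + b) = incl a + incl b :=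
  ext_of_l_of_r (fun c => by simp [add_mul]) (fun c => by simp [mul_add])

theorem incl_zero : incl (0 : A) = 0 :=
  ext_of_l_of_r (fun c => (zero_mul c).trans rfl) (fun c => (mul_zero c).trans rfl)

theorem incl_tmul (a : A) (b : B) : incl (a ⊗ₜ[ℂ] b) = tmul (incl a) (incl b) := by
  refine ext_of_l_of_r (fun z => ?_) (fun z => ?_)
  · induction z with
    | zero => simp
    | add z z' hz hz' => simp only [map_add, hz, hz']
    | tmul x y => simp [tmul_l]
  · induction z with
    | zero => simp
    | add z z' hz hz' => simp only [map_add, hz, hz']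
    | tmul x y => simp [tmul_r]

theorem tmul_mul_tmul (m m' : MultAlg A) (n n' : MultAlg B) :
    tmul m n * tmul m' n' = tmul (m * m') (n * n') := by
  refine ext_of_l_of_r (fun z => ?_) (fun z => ?_)
  · induction z with
    | zero => simp
    | add z z' hz hz' => simp only [map_add, hz, hz']
    | tmul x y => simp [tmul_l]
  · induction z with
    | zero => simp
    | add z z' hz hz' => simp only [map_add, hz, hz']
    | tmul x y => simp [tmul_r]

theorem leg₁₂_l (m : MultAlg (A ⊗[ℂ] A)) : (leg₁₂ m).l = opL A m.l := rfl

theorem leg₁₂_r (m : MultAlg (A ⊗[ℂ] A)) : (leg₁₂ m).r = opL A m.r := rfl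

/-- `E ⊗ 1` commutes with `1 ⊗ 1 ⊗ y`. -/
theorem leg₁₂_mul_third (m : MultAlg (A ⊗[ℂ] A)) (y : A) :
    leg₁₂ m * tmul 1 (tmul 1 (incl y)) = tmul 1 (tmul 1 (incl y)) * leg₁₂ m :=
  ext_of_l_of_r (fun z => opL_lTensor_lTensor m.l (LinearMap.mulLeft ℂ y) z)
    (fun z => (opL_lTensor_lTensor m.r (LinearMap.mulRight ℂ y) z).symm)

end MultAlg

theorem opL_tmul_eq {A M : Type*} [AddCommGroup A] [Module ℂ A] [AddCommGroup M] [Module ℂ M]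
    (f : A ⊗[ℂ] A →ₗ[ℂ] A ⊗[ℂ] A) (x : A) (z : A ⊗[ℂ] M) : opL M f (x ⊗ₜ z) =
      TensorProduct.assoc ℂ A A M
        (TensorProduct.map (f ∘ₗ TensorProduct.mk ℂ A A x) LinearMap.id z) := by
  induction z with
  | zero => simp
  | add z z' hz hz' => simp only [TensorProduct.tmul_add, map_add, hz, hz']
  | tmul a b => simp

theorem lTensor_assoc_tmul {A : Type*} [AddCommGroup A] [Module ℂ A]
    (g : A ⊗[ℂ] A →ₗ[ℂ] A ⊗[ℂ] A) (y : A) (z : A ⊗[ℂ] A) :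
    g.lTensor A (TensorProduct.assoc ℂ A A A (z ⊗ₜ y)) =
      (g ∘ₗ (TensorProduct.mk ℂ A A).flip y).lTensor A z := by
  induction z with
  | zero => simp
  | add z z' hz hz' => simp only [TensorProduct.add_tmul, map_add, hz, hz']
  | tmul a b => simp

end TensorMultipliers

namespace WeakMultiplierHopfAlgebra

variable {A : Type*} [NonUnitalRing A] [Module ℂ A] [IsScalarTower ℂ A A] [SMulCommClass ℂ A A]

section Basic

variable (H : WeakMultiplierHopfAlgebra A)

/-- This is coassociativity. -/
theorem legComm_T₂_T₁ : LegComm H.T₂ H.T₁ := by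
  refine LegComm.of_apply fun x a y => ?_
  rw [opL_tmul_eq, lTensor_assoc_tmul, H.coassoc]
  rfl

theorem legComm_E_r_E_l : LegComm H.E.r H.E.l := by
  apply LinearMap.ext
  intro w
  exact (l_r_comm (H.nondegenerate.tensor H.nondegenerate₂) (leg₂₃ H.E) (leg₁₂ H.E) w).symm

/-- In terms of Φ = ι ⊗ Δ: Φ(zE) = Φ(z)(1 ⊗ E)(E ⊗ 1) = Φ(z)(E ⊗ 1), because Φ(z) absorbs 1 ⊗ E, and
E ⊗ 1 commutes with 1 ⊗ 1 ⊗ y. -/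
theorem legComm_E_r_T₁ : LegComm H.E.r H.T₁ := by
  obtain ⟨Φ, h1, -, -, h3⟩ := H.id_tensor_Δ_E
  have key : ∀ (z : A ⊗[ℂ] A) (y : A),
      incl (H.T₁.lTensor A (TensorProduct.assoc ℂ A A A (z ⊗ₜ y))) =
        Φ (incl z) * tmul 1 (tmul 1 (incl y)) := by
    intro z y
    induction z with
    | zero => simp [incl_zero]
    | add z z' hz hz' => simp only [TensorProduct.add_tmul, map_add, incl_add, hz, hz', add_mul]
    | tmul u v =>
      rw [h1, tmul_mul_tmul, ← H.T₁_spec, mul_one, ← incl_tmul]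
      simp
  refine LegComm.of_apply fun x a y => ?_
  apply incl_injective (H.nondegenerate.tensor H.nondegenerate₂)
  rw [key, ← incl_mul_eq, map_mul, h3, h1, leg₂₃, ← mul_assoc, tmul_mul_tmul, mul_one, H.Δ_mul_E,
    mul_assoc, leg₁₂_mul_third, ← mul_assoc, ← h1, ← key, incl_mul_eq, leg₁₂_r]
  simp

theorem isCanonicalMap_T₁ : IsCanonicalMap H.T₁ H.E.l H.G₁ where
  full := H.full_left
  idem := LinearMap.ext H.E_l_idem
  range_eq := H.range_T₁
  spec := H.G₁_spec
  ker_eq := H.ker_T₁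

theorem isCanonicalMap_T₂ :
    IsCanonicalMap (flipConj H.T₂) (flipConj H.E.r) (flipConj H.G₂) where
  full V hV := by
    apply H.full_right
    rintro _ ⟨w, rfl⟩
    obtain ⟨u, hu⟩ := hV (LinearMap.mem_range_self _ (TensorProduct.comm ℂ A A w))
    rw [flipConj_apply, comm_comm] at hu
    refine ⟨TensorProduct.comm ℂ _ _ u, ?_⟩
    have e : ∀ u : V ⊗[ℂ] A, TensorProduct.map LinearMap.id V.subtype (TensorProduct.comm ℂ _ _ u) =
        TensorProduct.comm ℂ A A (TensorProduct.map V.subtype LinearMap.id u) := by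
      intro u
      induction u with
      | zero => simp
      | add z z' hz hz' => simp only [map_add, hz, hz']
      | tmul a b => simp
    rw [e, hu, comm_comm]
  idem := LinearMap.ext fun z => by simp [flipConj_apply, H.E_r_idem]
  range_eq := by
    apply le_antisymm
    · rintro _ ⟨w, rfl⟩
      obtain ⟨u, hu⟩ := H.exists_T₂_eq (TensorProduct.comm ℂ A A w)
      exact ⟨TensorProduct.comm ℂ A A u, by rw [flipConj_apply, comm_comm, hu]; rfl⟩
    · rintro _ ⟨w, rfl⟩
      exact ⟨flipConj H.T₂ w, by simp [flipConj_apply, H.E_r_T₂]⟩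
  spec a b c := by
    -- κ reverses the three legs and regroups them, which turns the defining identity of `G₂` into
    -- that of a map of type `G₁`.
    let κ : A ⊗[ℂ] (A ⊗[ℂ] A) →ₗ[ℂ] (A ⊗[ℂ] A) ⊗[ℂ] A :=
      (TensorProduct.map (TensorProduct.comm ℂ A A).toLinearMap LinearMap.id) ∘ₗ
        (TensorProduct.comm ℂ A (A ⊗[ℂ] A)).toLinearMap
    have e1 : ∀ (a : A) (z : A ⊗[ℂ] A), delta₁₃Right (flipConj H.T₂) (a ⊗ₜ z) =
        κ (delta₁₃Left H.T₂ (TensorProduct.comm ℂ A A z ⊗ₜ a)) := by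
      intro a z
      induction z with
      | zero => simp
      | add z z' hz hz' => simp only [TensorProduct.tmul_add, map_add, hz, hz',
          TensorProduct.add_tmul]
      | tmul b c =>
        simp only [delta₁₃Right, delta₁₃Left, LinearMap.comp_apply, LinearEquiv.coe_coe,
          TensorProduct.leftComm_tmul, TensorProduct.map_tmul, LinearMap.id_apply, flipConj_tmul,
          TensorProduct.comm_tmul, TensorProduct.rightComm_tmul]
        induction H.T₂ (c ⊗ₜ a) with
        | zero => simp
        | add z z' hz hz' => simp only [TensorProduct.tmul_add, map_add, hz, hz',
          TensorProduct.add_tmul]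
        | tmul p q => simp [κ]
    have e2 : ∀ w, TensorProduct.map (flipConj H.G₂) LinearMap.id (κ w) =
        κ (TensorProduct.map LinearMap.id H.G₂ w) := by
      intro w
      have : TensorProduct.map (flipConj H.G₂) LinearMap.id ∘ₗ κ =
          κ ∘ₗ TensorProduct.map LinearMap.id H.G₂ := by
        ext x y z
        simp [κ]
      exact LinearMap.congr_fun this w
    rw [e1, e2, TensorProduct.comm_tmul, H.G₂_spec, e1, flipConj_tmul, comm_comm]
  ker_eq := by
    ext z
    have h1 : TensorProduct.comm ℂ A A z ∈ LinearMap.ker H.T₂ ↔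
        TensorProduct.comm ℂ A A z ∈ LinearMap.range (LinearMap.id - H.G₂) := by rw [H.ker_T₂]
    rw [LinearMap.mem_ker, flipConj_apply, LinearEquiv.map_eq_zero_iff, ← LinearMap.mem_ker, h1]
    constructor
    · rintro ⟨w, hw⟩
      refine ⟨TensorProduct.comm ℂ A A w, ?_⟩
      have := congrArg (TensorProduct.comm ℂ A A) hw
      simpa [flipConj_apply] using this
    · rintro ⟨w, rfl⟩
      exact ⟨TensorProduct.comm ℂ A A w, by simp [flipConj_apply]⟩

theorem legComm_G₁ {f : Module.End ℂ (A ⊗[ℂ] A)} (hf : LegComm f H.T₁) : LegComm f H.G₁ :=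
  H.isCanonicalMap_T₁.legComm_proj hf

theorem legComm_G₂ {g : Module.End ℂ (A ⊗[ℂ] A)} (hg : LegComm H.T₂ g) : LegComm H.G₂ g :=
  (H.isCanonicalMap_T₂.legComm_proj hg.flipConj).of_flipConj

theorem exists_R₁ : ∃ R, IsGenInv H.T₁ H.E.l H.G₁ R := H.isCanonicalMap_T₁.exists_genInv

theorem exists_R₂ : ∃ R, IsGenInv H.T₂ H.E.r H.G₂ R := by
  obtain ⟨R, hR⟩ := H.isCanonicalMap_T₂.exists_genInv
  refine ⟨flipConj R, LinearMap.ext fun z => ?_, LinearMap.ext fun z => ?_,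
    LinearMap.ext fun z => ?_⟩
  · have := congrArg (TensorProduct.comm ℂ A A) (hR.apply_right (TensorProduct.comm ℂ A A z))
    simpa [flipConj_apply] using this
  · have := congrArg (TensorProduct.comm ℂ A A) (hR.apply_left (TensorProduct.comm ℂ A A z))
    simpa [flipConj_apply] using this
  · have := congrArg (TensorProduct.comm ℂ A A)
      (LinearMap.congr_fun hR.refl (TensorProduct.comm ℂ A A z))
    simpa [flipConj_apply] using this

end Basic

section Cop

variable {H K : WeakMultiplierHopfAlgebra A} (h : IsCop H K)
include h

/-- `flip(K.T₂(y ⊗ a)) = (1 ⊗ y)Δ(a)`. -/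
theorem IsCop.incl_comm_T₂ (a y : A) :
    incl (TensorProduct.comm ℂ A A (K.T₂ (y ⊗ₜ a))) = tmul 1 (incl y) * H.Δ a := by
  refine ext_of_l H.nondegenerate₂ fun z => ?_
  have := congrArg (TensorProduct.comm ℂ A A) (K.T₂_mul y a (TensorProduct.comm ℂ A A z))
  rw [comm_mul, comm_comm, comm_lm₁, h a, swap_l, flipConj_apply, comm_comm, comm_comm] at this
  exact this

theorem IsCop.legComm_E_l_flipConj_T₂ : LegComm H.E.l (flipConj K.T₂) := by
  obtain ⟨Φ, h1, -, h3, -⟩ := H.id_tensor_Δ_E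
  have key : ∀ (z : A ⊗[ℂ] A) (y : A),
      incl ((flipConj K.T₂).lTensor A (TensorProduct.assoc ℂ A A A (z ⊗ₜ y))) =
        tmul 1 (tmul 1 (incl y)) * Φ (incl z) := by
    intro z y
    induction z with
    | zero => simp [incl_zero]
    | add z z' hz hz' => simp only [TensorProduct.add_tmul, map_add, incl_add, hz, hz', mul_add]
    | tmul u v =>
      rw [h1, tmul_mul_tmul, ← h.incl_comm_T₂, one_mul, ← incl_tmul]
      simp
  refine LegComm.of_apply fun x a y => ?_
  apply incl_injective (H.nondegenerate.tensor H.nondegenerate₂)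
  rw [key, ← mul_incl_eq, map_mul, h3, h1, leg₂₃, mul_assoc, tmul_mul_tmul, one_mul, H.E_mul_Δ,
    ← mul_assoc, ← leg₁₂_mul_third, mul_assoc, ← h1, ← key, mul_incl_eq, leg₁₂_l]
  simp

/-- The axioms of `H` only describe (ι ⊗ Δ)E. The mirror statement for Δ ⊗ ι is the axiom of `K`,
read with the legs reversed and `K.E` the flip of `H.E`. -/
theorem IsCop.legComm_T₂_E_l : LegComm H.T₂ H.E.l := by
  have := h.symm.legComm_E_l_flipConj_T₂.flipConj
  rwa [flipConj_flipConj, h.E_eq, swap_l, flipConj_flipConj] at this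

variable {R₁ R₂ : Module.End ℂ (A ⊗[ℂ] A)}

theorem IsCop.legComm_T₂_R₁ (hR₁ : IsGenInv H.T₁ H.E.l H.G₁ R₁) : LegComm H.T₂ R₁ :=
  .genInv_right hR₁ H.legComm_T₂_T₁ h.legComm_T₂_E_l (H.legComm_G₁ H.legComm_T₂_T₁)

theorem IsCop.legComm_R₂_R₁ (hR₁ : IsGenInv H.T₁ H.E.l H.G₁ R₁)
    (hR₂ : IsGenInv H.T₂ H.E.r H.G₂ R₂) : LegComm R₂ R₁ :=
  .genInv_left hR₂ (h.legComm_T₂_R₁ hR₁)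
    (.genInv_right hR₁ H.legComm_E_r_T₁ H.legComm_E_r_E_l (H.legComm_G₁ H.legComm_E_r_T₁))
    (H.legComm_G₂ (h.legComm_T₂_R₁ hR₁))

end Cop

theorem legComm_R₂_T₁ {H : WeakMultiplierHopfAlgebra A} {R₂ : Module.End ℂ (A ⊗[ℂ] A)}
    (hR₂ : IsGenInv H.T₂ H.E.r H.G₂ R₂) : LegComm R₂ H.T₁ :=
  .genInv_left hR₂ H.legComm_T₂_T₁ H.legComm_E_r_T₁ (H.legComm_G₂ H.legComm_T₂_T₁)

end WeakMultiplierHopfAlgebra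

/-! ### The counital maps and the antipode -/

section Contractions

variable {A M : Type*} [AddCommGroup A] [Module ℂ A] [AddCommGroup M] [Module ℂ M]

theorem slL_lTensor_assoc (ω : A →ₗ[ℂ] ℂ) (z : A ⊗[ℂ] A) (m : M) :
    (slL ω).lTensor A (TensorProduct.assoc ℂ A A M (z ⊗ₜ m)) = slR ω z ⊗ₜ m := by
  induction z with
  | zero => simp
  | add z z' hz hz' => simp only [TensorProduct.add_tmul, map_add, hz, hz']
  | tmul a b => simp [TensorProduct.smul_tmul']

theorem functional_slR (ω η : A →ₗ[ℂ] ℂ) (z : A ⊗[ℂ] A) : η (slR ω z) = ω (slL η z) := by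
  induction z with
  | zero => simp
  | add z z' hz hz' => simp only [map_add, hz, hz']
  | tmul a b => simp [mul_comm]

/-- `w ↦ (ω ⊗ ι)(g(w ⊗ y))`. -/
def legL (ω : A →ₗ[ℂ] ℂ) (g : Module.End ℂ (A ⊗[ℂ] A)) (y : A) : A →ₗ[ℂ] A :=
  slL ω ∘ₗ g ∘ₗ (TensorProduct.mk ℂ A A).flip y

/-- `w ↦ (ι ⊗ ω)(f(x ⊗ w))`. -/
def legR (ω : A →ₗ[ℂ] ℂ) (f : Module.End ℂ (A ⊗[ℂ] A)) (x : A) : A →ₗ[ℂ] A :=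
  slR ω ∘ₗ f ∘ₗ TensorProduct.mk ℂ A A x

@[simp] theorem legL_apply (ω : A →ₗ[ℂ] ℂ) (g : Module.End ℂ (A ⊗[ℂ] A)) (y w : A) :
    legL ω g y w = slL ω (g (w ⊗ₜ y)) := rfl

@[simp] theorem legR_apply (ω : A →ₗ[ℂ] ℂ) (f : Module.End ℂ (A ⊗[ℂ] A)) (x w : A) :
    legR ω f x w = slR ω (f (x ⊗ₜ w)) := rfl

/-- `ω ↦ (ι ⊗ ω)(t)`. -/
def slRHom (t : A ⊗[ℂ] M) : (M →ₗ[ℂ] ℂ) →ₗ[ℂ] A where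
  toFun ω := slR ω t
  map_add' ω η := by
    induction t with
    | zero => simp
    | add z z' hz hz' => simp only [map_add, hz, hz']; abel
    | tmul a b => simp [add_smul]
  map_smul' c ω := by
    induction t with
    | zero => simp
    | add z z' hz hz' => simp only [map_add, hz, hz', smul_add]
    | tmul a b => simp [mul_smul]

end Contractions

namespace WeakMultiplierHopfAlgebra

variable {A : Type*} [NonUnitalRing A] [Module ℂ A] [IsScalarTower ℂ A A] [SMulCommClass ℂ A A]

section Basic

variable {H : WeakMultiplierHopfAlgebra A}

/-- The counit on the middle leg turns `T₂` into multiplication. The result says g(u ⊗ y) = ∑ u₍₁₎ ⊗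
(ε ⊗ ι)g(u₍₂₎ ⊗ y). The second factor is the target map for g = E, the source map for g = G₁ and the
antipode for g = R₁. -/
theorem lm₁_of_legComm {g : Module.End ℂ (A ⊗[ℂ] A)} (h : LegComm H.T₂ g) (x u y : A) :
    lm₁ x (g (u ⊗ₜ y)) = (legL H.ε g y).lTensor A (H.T₂ (x ⊗ₜ u)) := by
  have h1 := congrArg ((slL H.ε).lTensor A) (h.apply x (u ⊗ₜ y))
  have h2 : ∀ z : A ⊗[ℂ] A, (slL H.ε).lTensor A (opL A H.T₂ (x ⊗ₜ z)) = lm₁ x z := by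
    intro z
    induction z with
    | zero => simp
    | add z z' hz hz' => simp only [TensorProduct.tmul_add, map_add, hz, hz']
    | tmul a b => rw [opL_tmul, slL_lTensor_assoc, H.slR_T₂]; simp
  rw [h2, opL_tmul, lTensor_assoc_tmul, ← LinearMap.lTensor_comp_apply] at h1
  exact h1

theorem rm₂_of_legComm {f : Module.End ℂ (A ⊗[ℂ] A)} (h : LegComm f H.T₁) (x u y : A) :
    rm₂ y (f (x ⊗ₜ u)) = (legR H.ε f x).rTensor A (H.T₁ (u ⊗ₜ y)) := by
  have h1 := congrArg ((slL H.ε).lTensor A) (h.apply x (u ⊗ₜ y))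
  have h2 : ∀ z : A ⊗[ℂ] A, (slL H.ε).lTensor A (opL A f (x ⊗ₜ z)) =
      (legR H.ε f x).rTensor A z := by
    intro z
    induction z with
    | zero => simp
    | add z z' hz hz' => simp only [TensorProduct.tmul_add, map_add, hz, hz']
    | tmul a b => rw [opL_tmul, slL_lTensor_assoc]; simp
  have h3 : slL H.ε ∘ₗ H.T₁ ∘ₗ (TensorProduct.mk ℂ A A).flip y = LinearMap.mulRight ℂ y :=
    LinearMap.ext fun v => H.slL_T₁ v y
  rw [h2, opL_tmul, lTensor_assoc_tmul, ← LinearMap.lTensor_comp_apply, h3] at h1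
  exact h1.symm

variable (H)

/-- `∑ ε_s(a₍₁₎)b ⊗ a₍₂₎c = (1 ⊗ a)E(b ⊗ c)`. -/
theorem rTensor_legL_G₁ (a b c : A) :
    (legL H.ε H.G₁ b).rTensor A (H.T₁ (a ⊗ₜ c)) = lm₂ a (H.E.l (b ⊗ₜ c)) := by
  refine eq_of_slR fun ω => ?_
  have h1 := congrArg (slL H.ε) (H.isCanonicalMap_T₁.proj_sliceDelta ω (a ⊗ₜ (b ⊗ₜ c)))
  have h2 : ∀ z : A ⊗[ℂ] A, slL H.ε (sliceDelta H.T₁ ω (a ⊗ₜ z)) = slR ω (lm₂ a z) := by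
    intro z
    induction z with
    | zero => simp
    | add z z' hz hz' => simp only [TensorProduct.tmul_add, map_add, hz, hz']
    | tmul b c => simp [functional_slR, H.slL_T₁]
  rw [LinearMap.lTensor_tmul, h2, sliceDelta_tmul] at h1
  rw [slR_rTensor, ← h1, legL_apply]

/-- `∑ ac₍₁₎ ⊗ bε_t(c₍₂₎) = (a ⊗ b)E(c ⊗ 1)`. -/
theorem lTensor_legR_G₂ (a b c : A) :
    (legR H.ε H.G₂ b).lTensor A (H.T₂ (a ⊗ₜ c)) = rm₁ c (H.E.r (a ⊗ₜ b)) := by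
  apply (TensorProduct.comm ℂ A A).injective
  refine eq_of_slR fun ω => ?_
  rw [slR_comm, slR_comm]
  have h1 := congrArg (slL H.ε) (H.isCanonicalMap_T₂.proj_sliceDelta ω (c ⊗ₜ (b ⊗ₜ a)))
  have h2 : ∀ z : A ⊗[ℂ] A, slL H.ε (sliceDelta (flipConj H.T₂) ω
      (c ⊗ₜ TensorProduct.comm ℂ A A z)) = slL ω (rm₁ c z) := by
    intro z
    induction z with
    | zero => simp
    | add z z' hz hz' => simp only [TensorProduct.tmul_add, map_add, hz, hz']
    | tmul b c => simp [functional_slR, slL_comm, H.slR_T₂]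
  rw [LinearMap.lTensor_tmul, flipConj_tmul, h2, sliceDelta_tmul, flipConj_tmul, flipConj_tmul,
    slR_comm, slL_comm] at h1
  rw [slL_lTensor, ← h1, legR_apply]

/-- The two descriptions of the source map agree. -/
theorem mul_slL_G₁ (x v y : A) :
    x * slL H.ε (H.G₁ (v ⊗ₜ y)) = slR H.ε (H.E.r (x ⊗ₜ v)) * y := by
  suffices hs : LinearMap.mulLeft ℂ x ∘ₗ legL H.ε H.G₁ y -
      LinearMap.mulRight ℂ y ∘ₗ legR H.ε H.E.r x = 0 from
    sub_eq_zero.1 (LinearMap.congr_fun hs v)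
  refine eq_zero_of_full H.full_left _ fun a c => ?_
  rw [LinearMap.rTensor_sub, LinearMap.sub_apply, sub_eq_zero, LinearMap.rTensor_comp_apply,
    LinearMap.rTensor_comp_apply, H.rTensor_legL_G₁, ← rm₂_of_legComm H.legComm_E_r_T₁,
    ← mul_tmul_eq, r_mul_eq, tmul_mul_eq]

theorem eq_zero_of_full_right {V : Type*} [AddCommGroup V] [Module ℂ V] (k : A →ₗ[ℂ] V)
    (hk : ∀ a c, k.lTensor A (H.T₂ (a ⊗ₜ c)) = 0) : k = 0 := by
  refine eq_zero_of_full H.isCanonicalMap_T₂.full k fun a c => ?_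
  rw [flipConj_tmul, LinearMap.rTensor]
  have e : ∀ z : A ⊗[ℂ] A, TensorProduct.map k LinearMap.id (TensorProduct.comm ℂ A A z) =
      TensorProduct.comm ℂ A V (k.lTensor A z) := by
    intro z
    induction z with
    | zero => simp
    | add z z' hz hz' => simp only [map_add, hz, hz']
    | tmul a b => simp
  rw [e, hk, map_zero]

/-- `(ι ⊗ ε)((x ⊗ y)Δ(a)) = (ι ⊗ ε)((x ⊗ y)E)a`. -/
theorem slR_Δ_r (a : A) (z : A ⊗[ℂ] A) : slR H.ε ((H.Δ a).r z) = slR H.ε (H.E.r z) * a := by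
  rw [← H.Δ_r_E_r]
  obtain ⟨w, hw⟩ := H.exists_T₂_eq z
  rw [← hw]
  clear hw
  induction w with
  | zero => simp
  | add w w' hw hw' => simp only [map_add, hw, hw', add_mul]
  | tmul b c => rw [H.Δ_r_T₂, H.slR_T₂, H.slR_T₂, mul_assoc]

/-- `(ε ⊗ ι)(Δ(a)(x ⊗ y)) = a(ε ⊗ ι)(E(x ⊗ y))`. -/
theorem slL_Δ_l (a : A) (z : A ⊗[ℂ] A) : slL H.ε ((H.Δ a).l z) = a * slL H.ε (H.E.l z) := by
  rw [← H.Δ_l_E_l]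
  obtain ⟨w, hw⟩ := H.exists_T₁_eq z
  rw [← hw]
  clear hw
  induction w with
  | zero => simp
  | add w w' hw hw' => simp only [map_add, hw, hw', mul_add]
  | tmul b c => rw [H.Δ_l_T₁, H.slL_T₁, H.slL_T₁, mul_assoc]

theorem T₁_rm₂ (c : A) (z : A ⊗[ℂ] A) : H.T₁ (rm₂ c z) = rm₂ c (H.T₁ z) := by
  induction z with
  | zero => simp
  | add z z' hz hz' => simp only [map_add, hz, hz']
  | tmul a b => rw [H.rm₂_T₁]; simp

theorem T₁_lm₁ (p : A) (z : A ⊗[ℂ] A) : H.T₁ (lm₁ p z) = (H.Δ p).l (H.T₁ z) := by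
  induction z with
  | zero => simp
  | add z z' hz hz' => simp only [map_add, hz, hz']
  | tmul a b => rw [H.Δ_l_T₁]; simp

theorem G₁_rm₂ (c : A) (z : A ⊗[ℂ] A) : H.G₁ (rm₂ c z) = rm₂ c (H.G₁ z) := by
  suffices hs : H.G₁ ∘ₗ rm₂ c = rm₂ c ∘ₗ H.G₁ from LinearMap.congr_fun hs z
  refine H.isCanonicalMap_T₁.ext_sliceDelta fun ω w => ?_
  have e : ∀ w, rm₂ c (sliceDelta H.T₁ ω w) = sliceDelta H.T₁ ω ((rm₁ c).lTensor A w) := by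
    intro w
    have : rm₂ c ∘ₗ sliceDelta H.T₁ ω = sliceDelta H.T₁ ω ∘ₗ (rm₁ c).lTensor A := by
      ext a b d
      simp
    exact LinearMap.congr_fun this w
  rw [LinearMap.comp_apply, LinearMap.comp_apply, e, H.isCanonicalMap_T₁.proj_sliceDelta,
    H.isCanonicalMap_T₁.proj_sliceDelta, e, ← LinearMap.lTensor_comp_apply,
    ← LinearMap.lTensor_comp_apply]
  congr 3
  exact LinearMap.ext fun u => H.l_rm₁ H.E c u

variable {H}

/-- `T₁`, E and `G₁` commute with right multiplication in the second leg, hence so does the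
generalized inverse. It makes y ↦ (ε ⊗ ι)R₁(c ⊗ y) a left multiplier. -/
theorem R₁_rm₂ {R₁ : Module.End ℂ (A ⊗[ℂ] A)} (hR : IsGenInv H.T₁ H.E.l H.G₁ R₁) (c : A)
    (z : A ⊗[ℂ] A) : R₁ (rm₂ c z) = rm₂ c (R₁ z) := by
  have := commute_of_genInv (X := (rm₂ c : Module.End ℂ (A ⊗[ℂ] A))) hR.mul_right hR.mul_left
    hR.refl (LinearMap.ext fun u => (H.T₁_rm₂ c u).symm)
    (LinearMap.ext fun u => (H.l_rm₂ H.E c u).symm) (LinearMap.ext fun u => (H.G₁_rm₂ c u).symm)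
  exact (LinearMap.congr_fun this.eq z).symm

/-- The products `S(a)b` span `A`. -/
theorem slL_R₁_surjective {R₁ : Module.End ℂ (A ⊗[ℂ] A)} (hR : IsGenInv H.T₁ H.E.l H.G₁ R₁) :
    Function.Surjective (slL H.ε ∘ₗ R₁) := by
  rw [← LinearMap.range_eq_top]
  set V := LinearMap.range (slL H.ε ∘ₗ R₁) with hV
  -- ε_s(w)b = ∑ S(w₍₁₎)w₍₂₎b lies in V, since G₁ = R₁T₁.
  have hk : ∀ b, V.mkQ ∘ₗ legL H.ε H.G₁ b = 0 := by
    intro b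
    ext w
    rw [LinearMap.comp_apply, legL_apply, ← hR.apply_left]
    exact (Submodule.Quotient.mk_eq_zero V).2 ⟨H.T₁ (w ⊗ₜ b), rfl⟩
  -- Hence the first leg of (1 ⊗ d)E(b ⊗ c) lies in V. As E fixes the range of `T₁`, fullness then
  -- gives V = A.
  have h0 : ∀ d z, V.mkQ.rTensor A (lm₂ d (H.E.l z)) = 0 := by
    intro d z
    induction z with
    | zero => simp
    | add z z' hz hz' => simp only [map_add, hz, hz', add_zero]
    | tmul b c => rw [← H.rTensor_legL_G₁, ← LinearMap.rTensor_comp_apply, hk]; simp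
  rw [← V.ker_mkQ, LinearMap.ker_eq_top]
  refine eq_zero_of_full H.full_left _ fun a c => ?_
  refine eq_of_lm₂ H.nondegenerate fun d => ?_
  rw [map_zero, ← h0 d (H.T₁ (a ⊗ₜ c)), H.E_l_T₁]
  exact LinearMap.congr_fun ((LinearMap.lTensor_comp_rTensor _ _ _).trans
    (LinearMap.rTensor_comp_lTensor _ _ _).symm) _

end Basic

section Cop

variable {H K : WeakMultiplierHopfAlgebra A} (h : IsCop H K)
include h

/-- The two descriptions of the target map agree. -/
theorem IsCop.slR_G₂_mul (u v y : A) :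
    slR H.ε (H.G₂ (u ⊗ₜ v)) * y = u * slL H.ε (H.E.l (v ⊗ₜ y)) := by
  suffices hs : LinearMap.mulRight ℂ y ∘ₗ legR H.ε H.G₂ u -
      LinearMap.mulLeft ℂ u ∘ₗ legL H.ε H.E.l y = 0 from
    sub_eq_zero.1 (LinearMap.congr_fun hs v)
  refine H.eq_zero_of_full_right _ fun a c => ?_
  rw [LinearMap.lTensor_sub, LinearMap.sub_apply, sub_eq_zero, LinearMap.lTensor_comp_apply,
    LinearMap.lTensor_comp_apply, H.lTensor_legR_G₂, ← lm₁_of_legComm h.legComm_T₂_E_l]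
  have e1 := mul_tmul_eq (H.E.r (a ⊗ₜ u)) c y
  have e2 := tmul_mul_eq (H.E.l (c ⊗ₜ y)) a u
  rw [r_mul_eq, e2] at e1
  refine Eq.trans ?_ (e1.symm.trans ?_)
  · exact LinearMap.congr_fun ((LinearMap.lTensor_comp_rTensor _ _ _).trans
      (LinearMap.rTensor_comp_lTensor _ _ _).symm) _
  · exact LinearMap.congr_fun ((LinearMap.rTensor_comp_lTensor _ _ _).trans
      (LinearMap.lTensor_comp_rTensor _ _ _).symm) _

/-- The left and the right antipode agree. -/
theorem IsCop.slR_R₂_mul {R₁ R₂ : Module.End ℂ (A ⊗[ℂ] A)} (hR₁ : IsGenInv H.T₁ H.E.l H.G₁ R₁)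
    (hR₂ : IsGenInv H.T₂ H.E.r H.G₂ R₂) (x a y : A) :
    slR H.ε (R₂ (x ⊗ₜ a)) * y = x * slL H.ε (R₁ (a ⊗ₜ y)) := by
  let M : A ⊗[ℂ] (A ⊗[ℂ] A) →ₗ[ℂ] A :=
    LinearMap.mul' ℂ A ∘ₗ (LinearMap.mul' ℂ A).lTensor A
  have hM : ∀ z q, M (TensorProduct.assoc ℂ A A A (z ⊗ₜ q)) = LinearMap.mul' ℂ A z * q := by
    intro z q
    induction z with
    | zero => simp
    | add z z' hz hz' => simp only [TensorProduct.add_tmul, map_add, hz, hz', add_mul]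
    | tmul a b => simp [M, mul_assoc]
  have h1 : ∀ Z, slR H.ε (H.G₂ Z) * y =
      M (R₁.lTensor A (TensorProduct.assoc ℂ A A A (Z ⊗ₜ y))) := by
    intro Z
    induction Z with
    | zero => simp
    | add z z' hz hz' => simp only [TensorProduct.add_tmul, map_add, hz, hz', add_mul]
    | tmul u v =>
      rw [h.slR_G₂_mul, ← hR₁.apply_right, H.slL_T₁']
      simp [M]
  have h2 : ∀ Z, x * slL H.ε (H.G₁ Z) = M (opL A R₂ (x ⊗ₜ Z)) := by
    intro Z
    induction Z with
    | zero => simp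
    | add z z' hz hz' => simp only [TensorProduct.tmul_add, map_add, hz, hz', mul_add]
    | tmul u v => rw [H.mul_slL_G₁, ← hR₂.apply_right, H.slR_T₂', opL_tmul, hM]
  -- Convolution argument: both sides are ∑ xS(a₍₁₎)a₍₂₎S(a₍₃₎)y, with R₂ and R₁ applied to x ⊗ a ⊗
  -- y in either order.
  rw [← hR₂.proj_left, h1, ← hR₁.proj_left, h2, (h.legComm_R₂_R₁ hR₁ hR₂).apply, opL_tmul]

/-- `(x ⊗ w)Δ(b) = (x ⊗ 1)·(1 ⊗ w)Δ(b)`. -/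
theorem IsCop.lm₁_comm_T₂ (x w b : A) :
    lm₁ x (TensorProduct.comm ℂ A A (K.T₂ (w ⊗ₜ b))) = (H.Δ b).r (x ⊗ₜ w) := by
  refine eq_of_mul_right H.nondegenerate₂ fun v => ?_
  have := congrArg (fun m : MultAlg (A ⊗[ℂ] A) => m.l v) (h.incl_comm_T₂ b w)
  rw [incl_l, mul_l, tmul_one_incl_l] at this
  rw [lm₁_mul, this, r_mul_eq, tmul_mul_eq]

/-- `ε_s(w)b = (ι ⊗ ε)((1 ⊗ w)Δ(b))`. -/
theorem IsCop.slL_G₁ (z : A ⊗[ℂ] A) : slL H.ε (H.G₁ z) = slL H.ε (K.T₂ z) := by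
  induction z with
  | zero => simp
  | add z z' hz hz' => simp only [map_add, hz, hz']
  | tmul w b =>
    refine eq_of_mul_left H.nondegenerate fun x => ?_
    rw [H.mul_slL_G₁, ← H.slR_Δ_r, ← h.lm₁_comm_T₂, slR_rTensor, slR_comm]
    rfl

/-- The maps `a ↦ ∑ a₍₁₎ε(a₍₂₎y)` are left `A`-linear. -/
theorem IsCop.slR_rm₂_T₂ (q p a y : A) :
    slR H.ε (rm₂ y (H.T₂ (q ⊗ₜ (p * a)))) = slR H.ε (rm₂ y (H.T₂ ((q * p) ⊗ₜ a))) := by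
  have key : ∀ q c x, slR H.ε (rm₂ y (H.T₂ (q ⊗ₜ c))) * x =
      q * (c * slL K.ε (K.E.l (y ⊗ₜ x))) := by
    intro q c x
    rw [← K.slL_Δ_l, h c, swap_l, flipConj_tmul, slL_comm, h.ε_eq]
    have := congrArg (slR H.ε) ((mul_tmul_eq (H.T₂ (q ⊗ₜ c)) x y).symm.trans (H.T₂_mul q c _))
    rw [slR_rTensor, slR_rTensor] at this
    exact this
  refine eq_of_mul_right H.nondegenerate fun x => ?_
  rw [key, key]
  simp only [mul_assoc]

/-- G₁(a ⊗ b) = ∑ a₍₁₎ ⊗ ε_s(a₍₂₎)b, where ε_s(w)b depends on w only through the functional ε(w ·),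
as xε_s(w)b = (ι ⊗ ε)((x ⊗ w)Δ(b)). It remains to use the left linearity of a ↦ ∑ a₍₁₎ε(a₍₂₎y). -/
theorem IsCop.G₁_lm₁ (p : A) (z : A ⊗[ℂ] A) : H.G₁ (lm₁ p z) = lm₁ p (H.G₁ z) := by
  induction z with
  | zero => simp
  | add z z' hz hz' => simp only [map_add, hz, hz']
  | tmul a b =>
    refine eq_of_lm₁ H.nondegenerate fun q => ?_
    have hT := lm₁_of_legComm (H.legComm_G₁ H.legComm_T₂_T₁)
    rw [LinearMap.rTensor_tmul, LinearMap.mulLeft_apply, lm₁_lm₁, hT, hT]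
    refine eq_of_lm₂ H.nondegenerate fun x => ?_
    let e : A →ₗ[ℂ] A →ₗ[ℂ] ℂ := (LinearMap.mul ℂ A).compr₂ H.ε
    have he : LinearMap.mulLeft ℂ x ∘ₗ legL H.ε H.G₁ b = slRHom (H.T₂ (x ⊗ₜ b)) ∘ₗ e := by
      ext w
      simp only [LinearMap.comp_apply, LinearMap.mulLeft_apply, legL_apply]
      rw [H.mul_slL_G₁, ← H.slR_Δ_r, H.Δ_r_tmul, slR_lTensor]
      rfl
    rw [← LinearMap.lTensor_comp_apply, ← LinearMap.lTensor_comp_apply, he,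
      LinearMap.lTensor_comp_apply, LinearMap.lTensor_comp_apply]
    congr 1
    refine eq_of_lTensor (fun y : A => LinearMap.applyₗ (R := ℂ) (M₂ := ℂ) y)
      (fun v hv => LinearMap.ext hv) fun y => ?_
    apply (TensorProduct.rid ℂ A).injective
    have := h.slR_rm₂_T₂ q p a y
    rw [slR_lTensor, slR_lTensor] at this
    rw [← LinearMap.lTensor_comp_apply, ← LinearMap.lTensor_comp_apply]
    exact this

variable {R₁ R₁' : Module.End ℂ (A ⊗[ℂ] A)} (hR : IsGenInv H.T₁ H.E.l H.G₁ R₁)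
include hR

/-- R₁T₁ = G₁ fixes (p ⊗ 1)R₁(z), since R₁(z) is fixed by `G₁` and `G₁` is left linear in the first
leg. -/
theorem IsCop.R₁_of_T₁_eq (z z' : A ⊗[ℂ] A) (p : A) (hz : H.T₁ (lm₁ p (R₁ z)) = z') :
    R₁ z' = lm₁ p (R₁ z) := by
  rw [← hz, hR.apply_left, h.G₁_lm₁, hR.proj_left]

theorem IsCop.R₁_Δ_l (p : A) (z : A ⊗[ℂ] A) : R₁ ((H.Δ p).l z) = lm₁ p (R₁ z) := by
  apply h.R₁_of_T₁_eq hR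
  rw [H.T₁_lm₁, hR.apply_right, H.Δ_l_E_l]

/-- `∑ p ⊗ q ↦ ∑ (p ⊗ 1)R₁(b ⊗ q)`. -/
theorem IsCop.R₁_mul_tmul (a b c : A) : R₁ ((a * b) ⊗ₜ c) =
    TensorProduct.lift ((LinearMap.rTensorHom A ∘ₗ LinearMap.mul ℂ A).compl₂
      (R₁ ∘ₗ TensorProduct.mk ℂ A A b)) (R₁ (a ⊗ₜ c)) := by
  -- As (p ⊗ 1)R₁(b ⊗ q) = R₁(Δ(p)(b ⊗ q)), the contraction is R₁(T₁(Z)(b ⊗ 1)). For Z = R₁(a ⊗ c)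
  -- this leaves only a factor E, which R₁ absorbs.
  have key : ∀ Z, TensorProduct.lift ((LinearMap.rTensorHom A ∘ₗ LinearMap.mul ℂ A).compl₂
      (R₁ ∘ₗ TensorProduct.mk ℂ A A b)) Z = R₁ (rm₁ b (H.T₁ Z)) := by
    intro Z
    induction Z with
    | zero => simp
    | add z z' hz hz' => simp only [map_add, hz, hz']
    | tmul p q =>
      rw [← H.Δ_l_tmul, h.R₁_Δ_l hR]
      rfl
  rw [key, hR.apply_right, ← H.l_rm₁, hR.proj_right]
  simp

/-- This is S(S⁻¹(a)b) = S(b)a before S is known to take values in A. Evaluate (ε ⊗ ι)R₁ on Δ(p)(q ⊗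
y) and sum over p ⊗ q = R₁'(a ⊗ b). On one side `K.G₁` fixes R₁'(a ⊗ b); on the other `K.T₁` ∘ R₁'
is `K.E`, whose flip E is absorbed by R₁. -/
theorem IsCop.slL_R₁_slL_R₁ (hR' : IsGenInv K.T₁ K.E.l K.G₁ R₁') (a b y : A) :
    slL H.ε (R₁ (slL K.ε (R₁' (a ⊗ₜ b)) ⊗ₜ y)) = slL H.ε (R₁ (b ⊗ₜ (a * y))) := by
  have key : ∀ Z, slL H.ε (R₁ (rm₂ y (TensorProduct.comm ℂ A A (K.T₁ Z)))) =
      slL H.ε (R₁ (slL K.ε (K.G₁ Z) ⊗ₜ y)) := by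
    intro Z
    induction Z with
    | zero => simp
    | add z z' hz hz' => simp only [map_add, hz, hz', TensorProduct.add_tmul]
    | tmul p q =>
      have e : rm₂ y (TensorProduct.comm ℂ A A (K.T₁ (p ⊗ₜ q))) = (H.Δ p).l (q ⊗ₜ y) := by
        rw [← comm_rm₁, ← K.Δ_l_tmul, h p, swap_l, flipConj_tmul, comm_comm]
      rw [e, h.R₁_Δ_l hR, lm₁_of_legComm (h.legComm_T₂_R₁ hR), slL_lTensor, h.symm.slL_G₁, h.ε_eq]
      rfl
  rw [← hR'.proj_left, ← key, hR'.apply_right, h.E_eq, swap_l, flipConj_tmul, comm_comm,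
    ← H.l_rm₂, hR.proj_right]
  simp

end Cop

end WeakMultiplierHopfAlgebra

/-! ### From intertwined left multipliers to a bijective antipode -/

section Antipode

variable {A : Type*} [NonUnitalRing A] [Module ℂ A] [IsScalarTower ℂ A A] [SMulCommClass ℂ A A]

/-- With σ(a)y read as S(a)y and σ'(a)b as S⁻¹(a)b, the multiplier S(∑ S⁻¹(a)b) is given by the
element ∑ S(b)a of A. -/
theorem mul_eq_of_intertwine {σ σ' : A →ₗ[ℂ] A →ₗ[ℂ] A}
    (hσ : ∀ a b y, σ a (b * y) = σ a b * y)
    (h : ∀ a b y, σ (σ' a b) y = σ b (a * y)) (Z : A ⊗[ℂ] A) (y : A) :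
    TensorProduct.lift σ.flip Z * y = σ (TensorProduct.lift σ' Z) y := by
  induction Z with
  | zero => simp
  | add z z' hz hz' => simp only [map_add, add_mul, hz, hz', LinearMap.add_apply]
  | tmul a b => simp [h, hσ]

theorem exists_linearMap_of_intertwine {σ σ' : A →ₗ[ℂ] A →ₗ[ℂ] A}
    (hσ : ∀ a b y, σ a (b * y) = σ a b * y)
    (h : ∀ a b y, σ (σ' a b) y = σ b (a * y))
    (hs : Function.Surjective (TensorProduct.lift σ')) :
    ∃ S : A →ₗ[ℂ] A, ∀ c y, S c * y = σ c y := by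
  obtain ⟨s, hs⟩ := (TensorProduct.lift σ').exists_rightInverse_of_surjective
    (LinearMap.range_eq_top.2 hs)
  refine ⟨TensorProduct.lift σ.flip ∘ₗ s, fun c y => ?_⟩
  rw [LinearMap.comp_apply, mul_eq_of_intertwine hσ h]
  congr 2
  exact LinearMap.congr_fun hs c

/-- S sends σ'(a)b to σ(b)a and S' sends it back; these elements span A. Anti-multiplicativity
follows by moving every factor inside with S(c)y = S(S'(y)c). -/
theorem exists_antipode_of_intertwine (hA : NondegenerateProduct A) {σ σ' : A →ₗ[ℂ] A →ₗ[ℂ] A}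
    (hσ : ∀ a b y, σ a (b * y) = σ a b * y) (hσ' : ∀ a b y, σ' a (b * y) = σ' a b * y)
    (h : ∀ a b y, σ (σ' a b) y = σ b (a * y)) (h' : ∀ a b y, σ' (σ a b) y = σ' b (a * y))
    (hs : Function.Surjective (TensorProduct.lift σ))
    (hs' : Function.Surjective (TensorProduct.lift σ')) :
    ∃ S : A ≃ₗ[ℂ] A, (∀ c y, S c * y = σ c y) ∧ (∀ c y, S.symm c * y = σ' c y) ∧
      (∀ a b, S (a * b) = S b * S a) := by
  obtain ⟨S, hS⟩ := exists_linearMap_of_intertwine hσ h hs'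
  obtain ⟨S', hS'⟩ := exists_linearMap_of_intertwine hσ' h' hs
  have aux : ∀ {σ σ' : A →ₗ[ℂ] A →ₗ[ℂ] A} {S S' : A →ₗ[ℂ] A}
      (_ : ∀ a b y, σ a (b * y) = σ a b * y) (_ : ∀ a b y, σ' a (b * y) = σ' a b * y)
      (_ : ∀ a b y, σ (σ' a b) y = σ b (a * y)) (_ : ∀ a b y, σ' (σ a b) y = σ' b (a * y))
      (_ : Function.Surjective (TensorProduct.lift σ'))
      (_ : ∀ c y, S c * y = σ c y) (_ : ∀ c y, S' c * y = σ' c y) (c : A), S' (S c) = c := by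
    intro σ σ' S S' hσ hσ' h h' hs' hS hS' c
    obtain ⟨Z, rfl⟩ := hs' c
    refine eq_of_mul_right hA fun y => ?_
    have e : S (TensorProduct.lift σ' Z) = TensorProduct.lift σ.flip Z :=
      eq_of_mul_right hA fun y => by rw [hS, mul_eq_of_intertwine hσ h]
    rw [e, hS']
    induction Z with
    | zero => simp
    | add z z' hz hz' =>
      have e' : ∀ Z, S (TensorProduct.lift σ' Z) = TensorProduct.lift σ.flip Z := fun Z =>
        eq_of_mul_right hA fun y => by rw [hS, mul_eq_of_intertwine hσ h]
      simp only [map_add, LinearMap.add_apply, add_mul, hz (e' z), hz' (e' z')]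
    | tmul a b => simp [h', hσ']
  refine ⟨LinearEquiv.ofLinearMap S S' (LinearMap.ext (aux hσ' hσ h' h hs hS' hS))
    (LinearMap.ext (aux hσ hσ' h h' hs' hS hS')), hS, hS', fun a b => ?_⟩
  change S (a * b) = S b * S a
  have e : ∀ c y, S c * y = S (S' y * c) := fun c y => eq_of_mul_right hA fun w => by
    rw [hS, hS, hS', h, hσ]
  refine eq_of_mul_right hA fun y => ?_
  rw [mul_assoc, e, e a, e b, aux hσ hσ' h h' hs' hS hS', mul_assoc]

end Antipode

/-! ### Local units -/

section LeftIdeals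

theorem lift_curry_eq {V W X : Type*} [AddCommGroup V] [Module ℂ V] [AddCommGroup W] [Module ℂ W]
    [AddCommGroup X] [Module ℂ X] (f : V ⊗[ℂ] W →ₗ[ℂ] X) :
    TensorProduct.lift (TensorProduct.curry f) = f :=
  TensorProduct.ext' fun _ _ => rfl

variable {A : Type*} [NonUnitalRing A] [Module ℂ A] [IsScalarTower ℂ A A] [SMulCommClass ℂ A A]

variable (A) in
theorem IdempotentAlgebra.mul'_surjective (hA : IdempotentAlgebra A) :
    Function.Surjective (LinearMap.mul' ℂ A) := by
  rw [← LinearMap.range_eq_top, eq_top_iff, ← hA, Submodule.span_le]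
  rintro _ ⟨⟨a, b⟩, rfl⟩
  exact ⟨a ⊗ₜ b, by simp⟩

/-- The left ideal `Aa`. -/
def leftIdeal (a : A) : Submodule ℂ A := LinearMap.range (LinearMap.mulRight ℂ a)

/-- The action on `A/Aa` induced by a family of maps commuting with right multiplications. -/
def quotAct (φ : A →ₗ[ℂ] A →ₗ[ℂ] A) (hφ : ∀ p x y, φ p (x * y) = φ p x * y) (a : A) :
    A →ₗ[ℂ] (A ⧸ leftIdeal a) →ₗ[ℂ] (A ⧸ leftIdeal a) where
  toFun p := (leftIdeal a).mapQ (leftIdeal a) (φ p) (by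
    rintro _ ⟨x, rfl⟩
    exact ⟨φ p x, (hφ p x a).symm⟩)
  map_add' p q := by ext x; simp
  map_smul' c p := by ext x; simp

theorem lift_quotAct (φ : A →ₗ[ℂ] A →ₗ[ℂ] A) (hφ : ∀ p x y, φ p (x * y) = φ p x * y) (a : A)
    (Z : A ⊗[ℂ] A) : TensorProduct.lift (quotAct φ hφ a) ((leftIdeal a).mkQ.lTensor A Z) =
      (leftIdeal a).mkQ (TensorProduct.lift φ Z) := by
  induction Z with
  | zero => simp
  | add z z' hz hz' => simp only [map_add, hz, hz']
  | tmul p q => simp [quotAct]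

theorem exists_left_unit (hA : ∀ a : A, a ∈ leftIdeal a) (s : Finset A) :
    ∃ e : A, ∀ a ∈ s, e * a = a := by
  classical
  induction s using Finset.induction_on with
  | empty => exact ⟨0, by simp⟩
  | insert a s _ ih =>
    obtain ⟨e, he⟩ := ih
    obtain ⟨f, hf⟩ := hA (a - e * a)
    rw [LinearMap.mulRight_apply] at hf
    -- Formally 1 − (f + e − fe) = (1 − f)(1 − e), which kills what e fixes, and kills a because f
    -- fixes a − ea.
    refine ⟨f + e - f * e, fun b hb => ?_⟩
    rcases Finset.mem_insert.1 hb with rfl | hb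
    · rw [sub_mul, add_mul, mul_assoc, add_sub_right_comm, ← mul_sub, hf, sub_add_cancel]
    · rw [sub_mul, add_mul, mul_assoc, he b hb, add_sub_cancel_left]

/-- A vector v = ∑ aᵢyᵢ is fixed by any e with eaᵢ = aᵢ for the finitely many aᵢ, so Av = 0 forces v
= ev = 0. -/
theorem IsUnitalAction.isNondegenerate (hA : ∀ a : A, a ∈ leftIdeal a) {V : Type*}
    [AddCommGroup V] [Module ℂ V] {act : A →ₗ[ℂ] V →ₗ[ℂ] V} (h : IsLeftAction act)
    (hu : IsUnitalAction act) : IsNondegenerateAction act := by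
  classical
  intro v hv
  have key : ∀ v, ∃ s : Finset A, ∀ e, (∀ a ∈ s, e * a = a) → act e v = v := by
    intro v
    have hv' : v ∈ Submodule.span ℂ (Set.range fun p : A × V => act p.1 p.2) := by
      rw [show Submodule.span ℂ _ = ⊤ from hu]; trivial
    induction hv' using Submodule.span_induction with
    | mem x hx =>
      obtain ⟨⟨a, y⟩, rfl⟩ := hx
      exact ⟨{a}, fun e he => by rw [← h, he a (by simp)]⟩
    | zero => exact ⟨∅, by simp⟩
    | add x y _ _ hx hy =>
      obtain ⟨s, hs⟩ := hx
      obtain ⟨t, ht⟩ := hy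
      refine ⟨s ∪ t, fun e he => ?_⟩
      rw [map_add, hs e fun a ha => he a (Finset.mem_union_left t ha),
        ht e fun a ha => he a (Finset.mem_union_right s ha)]
    | smul c x _ hx =>
      obtain ⟨s, hs⟩ := hx
      exact ⟨s, fun e he => by rw [map_smul, hs e he]⟩
  obtain ⟨s, hs⟩ := key v
  obtain ⟨e, he⟩ := exists_left_unit hA s
  rw [← hs e he, hv]

end LeftIdeals

namespace WeakMultiplierHopfAlgebra

variable {A : Type*} [NonUnitalRing A] [Module ℂ A] [IsScalarTower ℂ A A] [SMulCommClass ℂ A A]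
variable {H K : WeakMultiplierHopfAlgebra A} (h : IsCop H K)

/-- T₁(w ⊗ a) = ∑ w₍₁₎ ⊗ w₍₂₎a has its second leg in Aa. -/
theorem mkQ_lTensor_T₁ (H : WeakMultiplierHopfAlgebra A) (a w : A) :
    (leftIdeal a).mkQ.lTensor A (H.T₁ (w ⊗ₜ a)) = 0 := by
  refine eq_of_lm₁ H.nondegenerate fun q => ?_
  have e : (leftIdeal a).mkQ ∘ₗ LinearMap.mulRight ℂ a = 0 := by
    ext x
    exact (Submodule.Quotient.mk_eq_zero _).2 ⟨x, rfl⟩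
  have e' := congrArg ((leftIdeal a).mkQ.lTensor A) (H.lm₁_T₁ w a q)
  rw [← LinearMap.lTensor_comp_apply, e] at e'
  rw [map_zero]
  refine Eq.trans ?_ (e'.trans (by simp))
  exact LinearMap.congr_fun ((LinearMap.rTensor_comp_lTensor _ _ _).trans
    (LinearMap.lTensor_comp_rTensor _ _ _).symm) _

/-- ε_s(w)a = ∑ S(w₍₁₎)w₍₂₎a, and left multipliers preserve Aa. -/
theorem mkQ_legL_G₁ (H : WeakMultiplierHopfAlgebra A) (a : A) :
    (leftIdeal a).mkQ ∘ₗ legL H.ε H.G₁ a = 0 := by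
  obtain ⟨R₁, hR⟩ := H.exists_R₁
  ext w
  rw [LinearMap.comp_apply, legL_apply, ← hR.apply_left]
  have e := lift_quotAct (TensorProduct.curry (slL H.ε ∘ₗ R₁)) (fun p x y => by
    have e := congrArg (slL H.ε) (R₁_rm₂ hR y (p ⊗ₜ x))
    rw [slL_lTensor] at e
    exact e) a (H.T₁ (w ⊗ₜ a))
  rw [H.mkQ_lTensor_T₁, map_zero, lift_curry_eq] at e
  exact e.symm

theorem mkQ_rTensor_lm₂_E (H : WeakMultiplierHopfAlgebra A) (a x y : A) :
    (leftIdeal a).mkQ.rTensor A (lm₂ x (H.E.l (a ⊗ₜ y))) = 0 := by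
  rw [← H.rTensor_legL_G₁, ← LinearMap.rTensor_comp_apply, H.mkQ_legL_G₁]
  simp

include h

/-- `E(uv ⊗ y) = ∑ u₍₁₎v ⊗ ε_t(u₍₂₎)y`. -/
theorem IsCop.rTensor_legL_E (y : A) (Z : A ⊗[ℂ] A) :
    (legL H.ε H.E.l y).rTensor A (K.T₁ Z) =
      TensorProduct.comm ℂ A A (H.E.l (LinearMap.mul' ℂ A Z ⊗ₜ y)) := by
  induction Z with
  | zero => simp
  | add z z' hz hz' => simp only [map_add, TensorProduct.add_tmul, hz, hz']
  | tmul u v =>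
    refine eq_of_lm₂ H.nondegenerate fun x => ?_
    have e0 : ∀ z : A ⊗[ℂ] A, (legL H.ε H.E.l y).rTensor A (TensorProduct.comm ℂ A A z) =
        TensorProduct.comm ℂ A A ((legL H.ε H.E.l y).lTensor A z) := by
      intro z
      induction z with
      | zero => simp
      | add z z' hz hz' => simp only [map_add, hz, hz']
      | tmul a b => simp
    have e1 := congrArg ((legL H.ε H.E.l y).rTensor A) (h.lm₂_T₁ u v x)
    have e2 : ∀ (f g : A →ₗ[ℂ] A) (z : A ⊗[ℂ] A), f.lTensor A (g.rTensor A z) =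
        g.rTensor A (f.lTensor A z) := fun f g z => LinearMap.congr_fun
      ((LinearMap.lTensor_comp_rTensor _ _ _).trans (LinearMap.rTensor_comp_lTensor _ _ _).symm) z
    rw [lm₂, e2, e1, rm₂, ← e2, e0, ← lm₁_of_legComm h.legComm_T₂_E_l, comm_lm₁]
    have e3 : LinearMap.mul' ℂ A (u ⊗ₜ[ℂ] v) ⊗ₜ[ℂ] y = rm₁ v (u ⊗ₜ[ℂ] y) := by simp
    rw [e3, H.l_rm₁, comm_rm₁, ← LinearMap.lTensor_comp_apply, ← LinearMap.lTensor_comp_apply]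
    congr 2
    ext
    simp [mul_assoc]

/-- The target maps of `H` and `K` have the same kernel: the vanishing of either one at p is
governed by the condition ε(ap) = 0 for all a. -/
theorem IsCop.slL_E_eq_zero {p : A} (hp : ∀ y, slL H.ε (H.E.l (p ⊗ₜ y)) = 0) (c : A) :
    slL K.ε (K.E.l (p ⊗ₜ c)) = 0 := by
  have h1 : ∀ a, H.ε (a * p) = 0 := by
    intro a
    have h2 : slR H.ε (K.T₁ (a ⊗ₜ p)) = 0 := by
      refine H.nondegenerate.1 _ fun y => ?_
      have h3 := H.slL_Δ_l a (p ⊗ₜ y)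
      rw [hp, mul_zero, h.symm a, swap_l, flipConj_tmul, K.Δ_l_tmul, slL_comm, slR_rTensor] at h3
      exact h3
    rw [← K.slL_T₁ a p, h.ε_eq, ← functional_slR, h2, map_zero]
  have h4 : H.ε ∘ₗ LinearMap.mulRight ℂ p = 0 := LinearMap.ext h1
  refine H.nondegenerate.2 _ fun a => ?_
  rw [← K.slL_Δ_l, h a, swap_l, flipConj_tmul, H.Δ_l_tmul, slL_comm, h.ε_eq, slR_rTensor]
  have h5 : slR H.ε (H.T₁ (a ⊗ₜ p)) = 0 := by
    refine H.nondegenerate.2 _ fun x => ?_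
    have := congrArg (slR H.ε) (H.lm₁_T₁ a p x)
    rw [slR_rTensor, slR_lTensor, h4] at this
    exact this.trans (by simp [slR])
  rw [h5]
  simp

/-- With a = ∑ uv, the element a is the sum of ε_t'(p)q over p ⊗ q = ∑ u₍₂₎ ⊗ u₍₁₎v, where ε_t' is
the target map of `K`. It must vanish modulo Aa. For each functional φ on A/Aa the element ∑ φ(q)p
is killed by ε_t, because ∑ q ⊗ ε_t(p)y is E(a ⊗ y), whose first leg lies in Aa. By `slL_E_eq_zero`,
ε_t' kills it too. -/
theorem IsCop.mem_leftIdeal (a : A) : a ∈ leftIdeal a := by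
  obtain ⟨Z, hZ⟩ := IdempotentAlgebra.mul'_surjective A H.idempotent a
  have hθ := lift_quotAct (TensorProduct.curry (slL K.ε ∘ₗ K.E.l)) (fun p x y => by
    have e := congrArg (slL K.ε) (K.l_rm₂ K.E y (p ⊗ₜ x))
    rw [slL_lTensor] at e
    exact e) a (K.T₁ Z)
  rw [lift_curry_eq, LinearMap.comp_apply, K.E_l_T₁, K.slL_T₁', hZ] at hθ
  rw [← (leftIdeal a).ker_mkQ, LinearMap.mem_ker, ← hθ]
  refine lift_eq_zero_of_slR _ _ fun φ => ?_
  have key : ∀ y, (legL H.ε H.E.l y).rTensor _ ((leftIdeal a).mkQ.lTensor A (K.T₁ Z)) = 0 := by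
    intro y
    refine eq_of_lm₁ H.nondegenerate fun x => ?_
    have e2 : ∀ (f : A →ₗ[ℂ] A ⧸ leftIdeal a) (g : A →ₗ[ℂ] A) (z : A ⊗[ℂ] A),
        g.rTensor _ (f.lTensor A z) = f.lTensor A (g.rTensor A z) := fun f g z =>
      LinearMap.congr_fun ((LinearMap.rTensor_comp_lTensor _ _ _).trans
        (LinearMap.lTensor_comp_rTensor _ _ _).symm) z
    have e3 : ∀ z : A ⊗[ℂ] A, (leftIdeal a).mkQ.lTensor A (TensorProduct.comm ℂ A A z) =
        TensorProduct.comm ℂ _ A ((leftIdeal a).mkQ.rTensor A z) := by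
      intro z
      induction z with
      | zero => simp
      | add z z' hz hz' => simp only [map_add, hz, hz']
      | tmul a b => simp
    rw [e2, lm₁, e2, h.rTensor_legL_E, ← comm_lm₂, e3, hZ, H.mkQ_rTensor_lm₂_E]
    simp
  have hp := h.slL_E_eq_zero (p := slR φ ((leftIdeal a).mkQ.lTensor A (K.T₁ Z))) fun y => by
    rw [← legL_apply, ← slR_rTensor, key, map_zero]
  ext x
  simp only [quotAct, LinearMap.coe_mk, AddHom.coe_mk, LinearMap.comp_apply, Submodule.mkQ_apply,
    Submodule.mapQ_apply, TensorProduct.curry_apply, LinearMap.zero_apply, hp]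
  simp

end WeakMultiplierHopfAlgebra

/-! ### The antipode and the target map -/

namespace WeakMultiplierHopfAlgebra

variable {A : Type*} [NonUnitalRing A] [Module ℂ A] [IsScalarTower ℂ A A] [SMulCommClass ℂ A A]
variable {H K : WeakMultiplierHopfAlgebra A} (h : IsCop H K)
  {R₁ R₁' : Module.End ℂ (A ⊗[ℂ] A)} (hR : IsGenInv H.T₁ H.E.l H.G₁ R₁)

include h hR

theorem IsCop.exists_antipode (hR' : IsGenInv K.T₁ K.E.l K.G₁ R₁') :
    ∃ S : A ≃ₗ[ℂ] A, (∀ c y, S c * y = slL H.ε (R₁ (c ⊗ₜ y))) ∧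
      (∀ c y, S.symm c * y = slL K.ε (R₁' (c ⊗ₜ y))) ∧ (∀ a b, S (a * b) = S b * S a) := by
  have aux : ∀ {H : WeakMultiplierHopfAlgebra A} {R₁ : Module.End ℂ (A ⊗[ℂ] A)}
      (_ : IsGenInv H.T₁ H.E.l H.G₁ R₁) (a b y : A),
      slL H.ε (R₁ (a ⊗ₜ (b * y))) = slL H.ε (R₁ (a ⊗ₜ b)) * y := by
    intro H R₁ hR a b y
    have e := congrArg (slL H.ε) (R₁_rm₂ hR y (a ⊗ₜ b))
    rw [slL_lTensor] at e
    exact e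
  refine exists_antipode_of_intertwine H.nondegenerate
    (σ := TensorProduct.curry (slL H.ε ∘ₗ R₁)) (σ' := TensorProduct.curry (slL K.ε ∘ₗ R₁'))
    (aux hR) (aux hR') (h.slL_R₁_slL_R₁ hR hR') (h.symm.slL_R₁_slL_R₁ hR' hR) ?_ ?_
  · rw [lift_curry_eq]; exact slL_R₁_surjective hR
  · rw [lift_curry_eq]; exact slL_R₁_surjective hR'

variable {S : A ≃ₗ[ℂ] A} (hS : ∀ c y, S c * y = slL H.ε (R₁ (c ⊗ₜ y)))
include hS

/-- `(c ⊗ 1)R₁(a ⊗ b) = ∑ ca₍₁₎ ⊗ S(a₍₂₎)b`. -/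
theorem IsCop.lm₁_R₁ (a b c : A) : lm₁ c (R₁ (a ⊗ₜ b)) =
    (LinearMap.mulRight ℂ b ∘ₗ S.toLinearMap).lTensor A (H.T₂ (c ⊗ₜ a)) := by
  rw [lm₁_of_legComm (h.legComm_T₂_R₁ hR)]
  congr 2
  ext w
  simp [hS]

/-- ∑ a₍₁₎ ⊗ S(a₍₂₎)S(c) = ∑ a₍₁₎ ⊗ S(ca₍₂₎). On such arguments R₁ is a canonical map of `K` up to
S, which yields both the explicit formulas for am and further commutations. -/
theorem IsCop.R₁_tmul_antipode (hm : ∀ a b, S (a * b) = S b * S a) (a c : A) :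
    R₁ (a ⊗ₜ S c) =
      S.toLinearMap.lTensor A (TensorProduct.comm ℂ A A (K.T₂ (c ⊗ₜ a))) := by
  refine eq_of_lm₁ H.nondegenerate fun b => ?_
  have e : LinearMap.mulRight ℂ (S c) ∘ₗ S.toLinearMap = S.toLinearMap ∘ₗ LinearMap.mulLeft ℂ c := by
    ext w
    simp [hm]
  rw [h.lm₁_R₁ hR hS, e, LinearMap.lTensor_comp_apply, ← H.Δ_r_tmul, ← h.lm₁_comm_T₂]
  exact LinearMap.congr_fun ((LinearMap.lTensor_comp_rTensor _ _ _).trans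
    (LinearMap.rTensor_comp_lTensor _ _ _).symm) _

/-- An operator on the last two legs that commutes with `K.T₂` on the first two also commutes
with the flip of `R₁`. -/
theorem IsCop.legComm_flipConj_R₁ (hm : ∀ a b, S (a * b) = S b * S a)
    {g : Module.End ℂ (A ⊗[ℂ] A)} (hg : LegComm K.T₂ g) : LegComm (flipConj R₁) g := by
  -- The flip of R₁ composed with S ⊗ ι is S ⊗ ι composed with `K.T₂`, and g does not touch the
  -- first leg.
  have key : ∀ (e : A) (w : A ⊗[ℂ] A), opL A (flipConj R₁) (S e ⊗ₜ w) =
      S.toLinearMap.rTensor _ (opL A K.T₂ (e ⊗ₜ w)) := by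
    intro e w
    induction w with
    | zero => simp
    | add z z' hz hz' => simp only [TensorProduct.tmul_add, map_add, hz, hz']
    | tmul a y =>
      rw [opL_tmul, opL_tmul, flipConj_tmul, h.R₁_tmul_antipode hR hS hm]
      induction K.T₂ (e ⊗ₜ a) with
      | zero => simp
      | add z z' hz hz' => simp only [TensorProduct.add_tmul, map_add, hz, hz']
      | tmul p q => simp
  refine LegComm.of_apply fun x a y => ?_
  obtain ⟨e, rfl⟩ := S.surjective x
  rw [← opL_tmul, key, key, hg.apply]
  exact LinearMap.congr_fun ((LinearMap.rTensor_comp_lTensor _ _ _).trans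
    (LinearMap.lTensor_comp_rTensor _ _ _).symm) _

omit h hS in
theorem slL_E_l_eq (a c : A) : slL H.ε (H.E.l (a ⊗ₜ c)) = LinearMap.mul' ℂ A (R₁ (a ⊗ₜ c)) := by
  rw [← hR.apply_right, H.slL_T₁']

/-- `b ε_t(a) = ∑ ba₍₁₎S(a₍₂₎)`. -/
theorem IsCop.mul'_lTensor_antipode_mul (a b c : A) :
    LinearMap.mul' ℂ A (S.toLinearMap.lTensor A (H.T₂ (b ⊗ₜ a))) * c =
      b * slL H.ε (H.E.l (a ⊗ₜ c)) := by
  have e1 : ∀ z : A ⊗[ℂ] A, b * LinearMap.mul' ℂ A z = LinearMap.mul' ℂ A (lm₁ b z) := by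
    intro z
    induction z with
    | zero => simp
    | add z z' hz hz' => simp only [map_add, mul_add, hz, hz']
    | tmul p q => simp [mul_assoc]
  rw [slL_E_l_eq hR, e1, h.lm₁_R₁ hR hS]
  induction H.T₂ (b ⊗ₜ a) with
  | zero => simp
  | add z z' hz hz' => simp only [map_add, add_mul, hz, hz']
  | tmul p q => simp [mul_assoc]

theorem IsCop.exists_target :
    ∃ εt : A →ₗ[ℂ] MultAlg A, ∀ a b, (εt a).l b = slL H.ε (H.E.l (a ⊗ₜ b)) := by
  have hc := h.mul'_lTensor_antipode_mul hR hS
  -- The right part is b ↦ ∑ ba₍₁₎S(a₍₂₎); its compatibility with the left part is `hc`.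
  let f : A → MultAlg A := fun a =>
    MultAlg.mk (legL H.ε (H.E.l ∘ₗ (TensorProduct.comm ℂ A A).toLinearMap) a)
      (LinearMap.mul' ℂ A ∘ₗ S.toLinearMap.lTensor A ∘ₗ H.T₂ ∘ₗ
        (TensorProduct.mk ℂ A A).flip a)
      (fun b c => by
        have e := congrArg (slL H.ε) (H.l_rm₂ H.E c (a ⊗ₜ b))
        rw [slL_lTensor] at e
        exact e)
      (fun b c => by
        refine eq_of_mul_right H.nondegenerate fun d => ?_
        rw [mul_assoc]
        exact (hc a (b * c) d).trans ((mul_assoc _ _ _).trans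
          (congrArg (b * ·) (hc a c d).symm)))
      (fun b c => hc a b c)
  have hf : ∀ a b, (f a).l b = slL H.ε (H.E.l (a ⊗ₜ b)) := fun a b => rfl
  refine ⟨{ toFun := f, map_add' := fun a b => ?_, map_smul' := fun c a => ?_ }, hf⟩
  · refine ext_of_l H.nondegenerate fun x => ?_
    rw [add_l, hf, hf, hf, TensorProduct.add_tmul, map_add, map_add]
  · refine ext_of_l H.nondegenerate fun x => ?_
    rw [RingHom.id_apply, smul_l, hf, hf, ← TensorProduct.smul_tmul', map_smul, map_smul]

end WeakMultiplierHopfAlgebra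

/-! ### Modules over multiplier algebras -/

section Modules

variable {A : Type*} [NonUnitalRing A] [Module ℂ A] [IsScalarTower ℂ A A] [SMulCommClass ℂ A A]
variable {V : Type*} [AddCommGroup V] [Module ℂ V] {act : A →ₗ[ℂ] V →ₗ[ℂ] V}

theorem IsUnitalAction.ext (hu : IsUnitalAction act) {W : Type*} [AddCommGroup W] [Module ℂ W]
    {f g : V →ₗ[ℂ] W} (hfg : ∀ c x, f (act c x) = g (act c x)) : f = g := by
  refine LinearMap.ext_on_range (v := fun p : A × V => act p.1 p.2) hu fun p => hfg p.1 p.2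

theorem IsUnitalAction.surjective (hu : IsUnitalAction act) :
    Function.Surjective (TensorProduct.lift act) := by
  rw [← LinearMap.range_eq_top, eq_top_iff, ← hu, Submodule.span_le]
  rintro _ ⟨⟨a, b⟩, rfl⟩
  exact ⟨a ⊗ₜ b, by simp⟩

theorem IsUnitalAction.exists_section (hu : IsUnitalAction act) :
    ∃ s : V →ₗ[ℂ] A ⊗[ℂ] V, ∀ v, TensorProduct.lift act (s v) = v := by
  obtain ⟨s, hs⟩ := (TensorProduct.lift act).exists_rightInverse_of_surjective
    (LinearMap.range_eq_top.2 hu.surjective)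
  exact ⟨s, LinearMap.congr_fun hs⟩

theorem IsNondegenerateAction.eq (hn : IsNondegenerateAction act) {v w : V}
    (h : ∀ a, act a v = act a w) : v = w := by
  rw [← sub_eq_zero]
  exact hn _ fun a => by rw [map_sub, h, sub_self]

/-- A unital non-degenerate module extends to the multiplier algebra. -/
theorem exists_multiplierExtension (ha : IsLeftAction act) (hu : IsUnitalAction act)
    (hn : IsNondegenerateAction act) :
    ∃ ρ : MultAlg A →ₐ[ℂ] Module.End ℂ V, (∀ a, ρ (incl a) = act a) ∧
      ∀ m c x, ρ m (act c x) = act (m.l c) x := by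
  obtain ⟨s, hs⟩ := hu.exists_section
  -- After acting by b, the result depends on Z only through the vector it represents, so by
  -- non-degeneracy the choice of section is irrelevant.
  have key : ∀ (m : MultAlg A) (b : A) Z, act b (TensorProduct.lift act (m.l.rTensor V Z)) =
      act (m.r b) (TensorProduct.lift act Z) := by
    intro m b Z
    induction Z with
    | zero => simp
    | add z z' hz hz' => simp only [map_add, hz, hz']
    | tmul c x => simp [← ha b, ← ha (m.r b), r_mul_eq]
  let f : MultAlg A → Module.End ℂ V := fun m => TensorProduct.lift act ∘ₗ m.l.rTensor V ∘ₗ s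
  have hf : ∀ m c x, f m (act c x) = act (m.l c) x := by
    intro m c x
    refine hn.eq fun b => ?_
    change act b (TensorProduct.lift act (m.l.rTensor V (s (act c x)))) = _
    rw [key, hs, ← ha, ← ha, r_mul_eq]
  refine ⟨{ toFun := f, map_one' := ?_, map_mul' := fun m n => ?_, map_zero' := ?_,
            map_add' := fun m n => ?_, commutes' := fun c => ?_ }, fun a => ?_, hf⟩
  · exact hu.ext fun c x => by rw [hf]; rfl
  · exact hu.ext fun c x => by rw [hf, Module.End.mul_apply, hf, hf]; rfl
  · exact hu.ext fun c x => by
      rw [hf, show (0 : MultAlg A).l c = 0 from rfl]; simp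
  · exact hu.ext fun d x => by
      change f (m + n) (act d x) = f m (act d x) + f n (act d x)
      rw [hf, hf, hf, add_l, map_add]; rfl
  · exact hu.ext fun d x => by
      change f (algebraMap ℂ _ c) (act d x) = _
      rw [hf, Algebra.algebraMap_eq_smul_one, smul_l, one_l, map_smul]; rfl
  · exact hu.ext fun c x => by
      change f (incl a) (act c x) = _
      rw [hf, incl_l, ha]

variable (act)

/-- `p ⊗ q ↦ p(g(qx))`. -/
def sandwich (g : V →ₗ[ℂ] V) (x : V) : A ⊗[ℂ] A →ₗ[ℂ] V :=
  TensorProduct.lift (act.compl₂ (g ∘ₗ act.flip x))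

@[simp] theorem sandwich_tmul (g : V →ₗ[ℂ] V) (x : V) (p q : A) :
    sandwich act g x (p ⊗ₜ q) = act p (g (act q x)) := rfl

variable {act}

theorem act_sandwich (ha : IsLeftAction act) (g : V →ₗ[ℂ] V) (x : V) (b : A) (z : A ⊗[ℂ] A) :
    act b (sandwich act g x z) = sandwich act g x (lm₁ b z) := by
  induction z with
  | zero => simp
  | add z z' hz hz' => simp only [map_add, hz, hz']
  | tmul c x => simp [← ha b]

theorem sandwich_lTensor_mulRight (ha : IsLeftAction act) (g : V →ₗ[ℂ] V) (x : V) (c : A)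
    (S : A →ₗ[ℂ] A) (z : A ⊗[ℂ] A) :
    sandwich act g x ((LinearMap.mulRight ℂ c ∘ₗ S).lTensor A z) =
      sandwich act g (act c x) (S.lTensor A z) := by
  induction z with
  | zero => simp
  | add z z' hz hz' => simp only [map_add, hz, hz']
  | tmul p q => simp [ha (S q)]

/-- For `Q(a ⊗ c) = ∑ a₍₁₎ ⊗ S(a₍₂₎)c`, the maps `v ↦ ∑ a₍₁₎g(S(a₍₂₎)v)` on `V`. -/
theorem exists_adjointAction (ha : IsLeftAction act) (hu : IsUnitalAction act)
    (hn : IsNondegenerateAction act) {Q T : Module.End ℂ (A ⊗[ℂ] A)} {S : A →ₗ[ℂ] A}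
    (hQ : ∀ a b c, lm₁ c (Q (a ⊗ₜ b)) = (LinearMap.mulRight ℂ b ∘ₗ S).lTensor A (T (c ⊗ₜ a))) :
    ∃ L : A →ₗ[ℂ] (V →ₗ[ℂ] V) →ₗ[ℂ] (V →ₗ[ℂ] V),
      ∀ a g c x, L a g (act c x) = sandwich act g x (Q (a ⊗ₜ c)) := by
  obtain ⟨s, hs⟩ := hu.exists_section
  let pre : A → (V →ₗ[ℂ] V) → (A ⊗[ℂ] V →ₗ[ℂ] V) := fun a g =>
    TensorProduct.lift act ∘ₗ (g ∘ₗ TensorProduct.lift act).lTensor A ∘ₗ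
      (TensorProduct.assoc ℂ A A V).toLinearMap ∘ₗ (Q ∘ₗ TensorProduct.mk ℂ A A a).rTensor V
  have hpre : ∀ a g c x, pre a g (c ⊗ₜ x) = sandwich act g x (Q (a ⊗ₜ c)) := by
    intro a g c x
    simp only [pre, LinearMap.comp_apply, LinearMap.rTensor_tmul, TensorProduct.mk_apply,
      LinearEquiv.coe_coe]
    induction Q (a ⊗ₜ c) with
    | zero => simp
    | add z z' hz hz' => simp only [TensorProduct.add_tmul, map_add, hz, hz']
    | tmul p q => simp
  -- Acting by b replaces the formal a₍₁₎ ⊗ S(a₍₂₎) by an element of A ⊗ A, and only the vector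
  -- represented by Z remains.
  have key : ∀ a g b Z, act b (pre a g Z) =
      sandwich act g (TensorProduct.lift act Z) (S.lTensor A (T (b ⊗ₜ a))) := by
    intro a g b Z
    induction Z with
    | zero =>
      have : sandwich act g 0 = 0 := by ext; simp
      simp [this]
    | add z z' hz hz' =>
      have : ∀ x y, sandwich act g (x + y) = sandwich act g x + sandwich act g y := by
        intro x y; ext; simp
      simp only [map_add, hz, hz', this, LinearMap.add_apply]
    | tmul c x => rw [hpre, act_sandwich ha, hQ, sandwich_lTensor_mulRight ha]; rfl
  have hL : ∀ a g c x, pre a g (s (act c x)) = sandwich act g x (Q (a ⊗ₜ c)) := by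
    intro a g c x
    refine hn.eq fun b => ?_
    rw [← hpre, key, key, hs]
    rfl
  have hadd : ∀ g g' x, sandwich act (g + g') x = sandwich act g x + sandwich act g' x := by
    intro g g' x; ext; simp
  have hsmul : ∀ (c : ℂ) g x, sandwich act (c • g) x = c • sandwich act g x := by
    intro c g x; ext; simp
  refine ⟨LinearMap.mk₂ ℂ (fun a g => pre a g ∘ₗ s) ?_ ?_ ?_ ?_, hL⟩
  · intro a a' g
    refine hu.ext fun c x => ?_
    change pre _ g _ = pre _ g _ + pre _ g _
    rw [hL, hL, hL, TensorProduct.add_tmul, map_add, map_add]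
  · intro k a g
    refine hu.ext fun c x => ?_
    change pre _ g _ = k • pre _ g _
    rw [hL, hL, ← TensorProduct.smul_tmul', map_smul, map_smul]
  · intro a g g'
    refine hu.ext fun c x => ?_
    change pre _ _ _ = pre _ _ _ + pre _ _ _
    rw [hL, hL, hL, hadd]; rfl
  · intro k a g
    refine hu.ext fun c x => ?_
    change pre _ _ _ = k • pre _ _ _
    rw [hL, hL, hsmul]; rfl

end Modules

/-! ### Invariant products on modules -/

namespace WeakMultiplierHopfAlgebra

variable {A : Type*} [NonUnitalRing A] [Module ℂ A] [IsScalarTower ℂ A A] [SMulCommClass ℂ A A]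
variable {V : Type*} [AddCommGroup V] [Module ℂ V] {act : A →ₗ[ℂ] V →ₗ[ℂ] V}
variable {H : WeakMultiplierHopfAlgebra A}

variable (act H) in
/-- The bilinear map `π` satisfies `a π(x, y) = ∑ π(a₍₁₎x, a₍₂₎y)`. -/
def IsInvariantProduct (π : V →ₗ[ℂ] V →ₗ[ℂ] V) : Prop :=
  ∀ (a b c : A) (x y : V), act a (π (act b x) (act c y)) =
    TensorProduct.lift π (TensorProduct.map (act.flip x) (act.flip y) ((H.Δ a).l (b ⊗ₜ c)))

variable {π : V →ₗ[ℂ] V →ₗ[ℂ] V} (hπ : IsInvariantProduct act H π)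
include hπ

theorem IsInvariantProduct.act_lift (a : A) (x y : V) (z : A ⊗[ℂ] A) :
    act a (TensorProduct.lift π (TensorProduct.map (act.flip x) (act.flip y) z)) =
      TensorProduct.lift π (TensorProduct.map (act.flip x) (act.flip y) ((H.Δ a).l z)) := by
  induction z with
  | zero => simp
  | add z z' hz hz' => simp only [map_add, hz, hz']
  | tmul b c => exact hπ a b c x y

theorem IsInvariantProduct.sandwich_eq (d : A) (v y : V) (z : A ⊗[ℂ] A) :
    sandwich act (π (act d v)) y z = TensorProduct.lift π
      (TensorProduct.map (act.flip v) (act.flip y) (rm₁ d (H.T₁ z))) := by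
  induction z with
  | zero => simp
  | add z z' hz hz' => simp only [map_add, hz, hz']
  | tmul p q => rw [← H.Δ_l_tmul, ← hπ]; rfl

/-- For w = dv the expression depends on z only through T₁(z), and T₁G₁ = ET₁ = T₁. -/
theorem IsInvariantProduct.sandwich_G₁ (hu : IsUnitalAction act) {R₁ : Module.End ℂ (A ⊗[ℂ] A)}
    (hR : IsGenInv H.T₁ H.E.l H.G₁ R₁) (w y : V) (z : A ⊗[ℂ] A) :
    sandwich act (π w) y (H.G₁ z) = sandwich act (π w) y z := by
  have hlin : ∀ z, ∃ f : V →ₗ[ℂ] V, ∀ w, f w = sandwich act (π w) y z := by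
    intro z
    refine ⟨{ toFun := fun w => sandwich act (π w) y z, map_add' := ?_, map_smul' := ?_ },
      fun w => rfl⟩
    · intro w w'
      have : sandwich act (π (w + w')) y = sandwich act (π w) y + sandwich act (π w') y := by
        ext; simp
      rw [this]; rfl
    · intro c w
      have : sandwich act (π (c • w)) y = c • sandwich act (π w) y := by ext; simp
      rw [this]; rfl
  obtain ⟨f, hf⟩ := hlin (H.G₁ z)
  obtain ⟨g, hg⟩ := hlin z
  rw [← hf, ← hg]
  refine LinearMap.congr_fun (hu.ext fun d v => ?_) w
  rw [hf, hg, hπ.sandwich_eq, hπ.sandwich_eq, ← hR.apply_left, hR.apply_right, H.E_l_T₁]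

/-- `π(aw, cy) = ∑ a₍₁₎π(w, S(a₍₂₎)cy)`. -/
theorem IsInvariantProduct.apply_act (ha : IsLeftAction act) (hu : IsUnitalAction act)
    (hn : IsNondegenerateAction act) {R₁ : Module.End ℂ (A ⊗[ℂ] A)}
    (hR : IsGenInv H.T₁ H.E.l H.G₁ R₁) (a c : A) (w y : V) :
    π (act a w) (act c y) = sandwich act (π w) y (R₁ (a ⊗ₜ c)) := by
  -- E is invisible after applying π: acting by b produces Δ(b)E = Δ(b), and the module is
  -- non-degenerate.
  have hE : ∀ v y z, TensorProduct.lift π (TensorProduct.map (act.flip v) (act.flip y) (H.E.l z)) =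
      TensorProduct.lift π (TensorProduct.map (act.flip v) (act.flip y) z) := by
    intro v y z
    refine hn.eq fun b => ?_
    rw [hπ.act_lift, hπ.act_lift, H.Δ_l_E_l]
  have hw : w ∈ Submodule.span ℂ (Set.range fun p : A × V => act p.1 p.2) := by
    rw [show Submodule.span ℂ _ = ⊤ from hu]; trivial
  induction hw using Submodule.span_induction with
  | mem x hx =>
    obtain ⟨⟨d, v⟩, rfl⟩ := hx
    have e : rm₁ d (a ⊗ₜ[ℂ] c) = (a * d) ⊗ₜ c := by simp
    simp only
    rw [hπ.sandwich_eq, hR.apply_right, ← H.l_rm₁, hE, e, ← ha]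
    rfl
  | zero =>
    have : sandwich act (0 : V →ₗ[ℂ] V) y = 0 := by ext; simp
    simp [this]
  | add x x' _ _ hx hx' =>
    have : sandwich act (π (x + x')) y = sandwich act (π x) y + sandwich act (π x') y := by
      ext; simp
    rw [this, LinearMap.add_apply, ← hx, ← hx', map_add, map_add, LinearMap.add_apply]
  | smul k x _ hx =>
    have : sandwich act (π (k • x)) y = k • sandwich act (π x) y := by ext; simp
    rw [this, LinearMap.smul_apply, ← hx, map_smul, map_smul, LinearMap.smul_apply]

end WeakMultiplierHopfAlgebra

/-! ### The action on the multiplier algebra of a module algebra -/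

namespace WeakMultiplierHopfAlgebra

variable {A : Type*} [NonUnitalRing A] [Module ℂ A] [IsScalarTower ℂ A A] [SMulCommClass ℂ A A]
variable {R : Type*} [NonUnitalRing R] [Module ℂ R] [IsScalarTower ℂ R R] [SMulCommClass ℂ R R]
variable {act : A →ₗ[ℂ] R →ₗ[ℂ] R} {H K : WeakMultiplierHopfAlgebra A}

theorem _root_.IsModuleAlgebra.isInvariantProduct_mul (hR : IsModuleAlgebra H act) :
    IsInvariantProduct act H (LinearMap.mul ℂ R) := hR.act_mul

theorem _root_.IsModuleAlgebra.isInvariantProduct_flip_mul (hR : IsModuleAlgebra H act)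
    (h : IsCop H K) : IsInvariantProduct act K (LinearMap.mul ℂ R).flip := by
  intro a b c x y
  rw [h a, swap_l, flipConj_tmul]
  refine (hR.act_mul a c b y x).trans ?_
  induction (H.Δ a).l (c ⊗ₜ b) with
  | zero => simp
  | add z z' hz hz' => simp only [map_add, hz, hz']
  | tmul p q => simp

variable (act) in
/-- `q' ⊗ (p ⊗ q) ↦ p(((q'z)m)(qx))`. -/
def doubleSandwich (m : MultAlg R) (z x : R) : A ⊗[ℂ] (A ⊗[ℂ] A) →ₗ[ℂ] R :=
  TensorProduct.lift act ∘ₗ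
    (LinearMap.mul' ℂ R ∘ₗ TensorProduct.map (m.r ∘ₗ act.flip z) (act.flip x)).lTensor A ∘ₗ
      (TensorProduct.leftComm ℂ A A A).toLinearMap

theorem doubleSandwich_tmul (m : MultAlg R) (z x : R) (q : A) (w : A ⊗[ℂ] A) :
    doubleSandwich act m z x (q ⊗ₜ w) =
      sandwich act (LinearMap.mul ℂ R (m.r (act q z))) x w := by
  induction w with
  | zero => simp
  | add z z' hz hz' => simp only [TensorProduct.tmul_add, map_add, hz, hz']
  | tmul a b => simp [doubleSandwich]

theorem doubleSandwich_assoc_comm (m : MultAlg R) (z x : R) (q : A) (u : A ⊗[ℂ] A) :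
    doubleSandwich act m z x (TensorProduct.assoc ℂ A A A (TensorProduct.comm ℂ A A u ⊗ₜ q)) =
      sandwich act ((LinearMap.mul ℂ R).flip (m.l (act q x))) z u := by
  induction u with
  | zero => simp
  | add z z' hz hz' => simp only [TensorProduct.add_tmul, map_add, hz, hz']
  | tmul a b => simp [doubleSandwich, r_mul_eq]

variable (hR : IsModuleAlgebra H act) (hn : IsNondegenerateAction act)
  {R₁ R₁' : Module.End ℂ (A ⊗[ℂ] A)}
include hR hn

/-- `apply_act` for the opposite product over `K` reads (ez)(pr) = ∑ p₍₂₎((S⁻¹(p₍₁₎)ez)r). It moves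
p outside, after which m can be read as acting from the right on z. -/
theorem mul_sandwich (h : IsCop H K) (hR₁' : IsGenInv K.T₁ K.E.l K.G₁ R₁') (m : MultAlg R)
    (e : A) (z x : R) (t : A ⊗[ℂ] A) :
    act e z * sandwich act m.l x t =
      doubleSandwich act m z x (opL A (flipConj R₁') (e ⊗ₜ t)) := by
  induction t with
  | zero => simp
  | add z z' hz hz' => simp only [TensorProduct.tmul_add, map_add, mul_add, hz, hz']
  | tmul p q =>
    rw [opL_tmul, flipConj_tmul, doubleSandwich_assoc_comm,
      ← (hR.isInvariantProduct_flip_mul h).apply_act hR.isLeftAction hR.isUnital hn hR₁']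
    simp

theorem sandwich_mul (hR₁ : IsGenInv H.T₁ H.E.l H.G₁ R₁) (m : MultAlg R)
    (d : A) (z x : R) (u : A ⊗[ℂ] A) :
    sandwich act m.r z u * act d x = doubleSandwich act m z x
      (R₁.lTensor A (TensorProduct.assoc ℂ A A A (TensorProduct.comm ℂ A A u ⊗ₜ d))) := by
  induction u with
  | zero => simp
  | add z z' hz hz' => simp only [TensorProduct.add_tmul, map_add, add_mul, hz, hz']
  | tmul p q =>
    rw [TensorProduct.comm_tmul, TensorProduct.assoc_tmul, LinearMap.lTensor_tmul,
      doubleSandwich_tmul,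
      ← hR.isInvariantProduct_mul.apply_act hR.isLeftAction hR.isUnital hn hR₁]
    simp

/-- Multiplying from the left by ez replaces m by left multiplication with elements (q'z)m of R, for
which `sandwich_G₁` holds. The commutation hypothesis brings `G₁` to the place where it can be
dropped. -/
theorem sandwich_l_G₁ (h : IsCop H K) (hR₁ : IsGenInv H.T₁ H.E.l H.G₁ R₁)
    (hR₁' : IsGenInv K.T₁ K.E.l K.G₁ R₁') (hcomm : LegComm (flipConj R₁') H.G₁)
    (m : MultAlg R) (x : R) (t : A ⊗[ℂ] A) :
    sandwich act m.l x (H.G₁ t) = sandwich act m.l x t := by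
  refine eq_of_mul_left hR.nondegenerate fun z => ?_
  suffices hs : LinearMap.mulRight ℂ (sandwich act m.l x (H.G₁ t)) =
      LinearMap.mulRight ℂ (sandwich act m.l x t) from LinearMap.congr_fun hs z
  refine hR.isUnital.ext fun e z => ?_
  rw [LinearMap.mulRight_apply, LinearMap.mulRight_apply, mul_sandwich hR hn h hR₁',
    mul_sandwich hR hn h hR₁', hcomm.apply]
  have key : ∀ w, doubleSandwich act m z x (H.G₁.lTensor A w) = doubleSandwich act m z x w := by
    intro w
    induction w with
    | zero => simp
    | add z z' hz hz' => simp only [map_add, hz, hz']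
    | tmul q w =>
      rw [LinearMap.lTensor_tmul, doubleSandwich_tmul, doubleSandwich_tmul,
        hR.isInvariantProduct_mul.sandwich_G₁ hR.isUnital hR₁]
  rw [key]

/-- The action of `A` on `M(R)`. -/
theorem exists_multiplierAction (h : IsCop H K) (hR₁ : IsGenInv H.T₁ H.E.l H.G₁ R₁)
    (hR₁' : IsGenInv K.T₁ K.E.l K.G₁ R₁') {S : A ≃ₗ[ℂ] A}
    (hS : ∀ c y, S c * y = slL H.ε (R₁ (c ⊗ₜ y)))
    (hS' : ∀ c y, S.symm c * y = slL K.ε (R₁' (c ⊗ₜ y)))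
    (hcomm : LegComm (flipConj R₁') R₁) :
    ∃ ext : A →ₗ[ℂ] MultAlg R →ₗ[ℂ] MultAlg R,
      (∀ a m c x, (ext a m).l (act c x) = sandwich act m.l x (R₁ (a ⊗ₜ c))) ∧
      (∀ a m c x, (ext a m).r (act c x) = sandwich act m.r x (R₁' (a ⊗ₜ c))) := by
  obtain ⟨L, hL⟩ := exists_adjointAction hR.isLeftAction hR.isUnital hn
    (fun a b c => h.lm₁_R₁ hR₁ hS a b c)
  obtain ⟨L', hL'⟩ := exists_adjointAction hR.isLeftAction hR.isUnital hn
    (fun a b c => h.symm.lm₁_R₁ hR₁' hS' a b c)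
  -- On z = ez', x = dx' both sides come from e ⊗ a ⊗ d, with the flip of R₁' on legs 1, 2 and R₁ on
  -- legs 2, 3 applied in the two possible orders.
  have hcompat : ∀ a (m : MultAlg R) z x, L' a m.r z * x = z * L a m.l x := by
    intro a m z x
    suffices hs : (LinearMap.mul ℂ R) ∘ₗ (L' a m.r) =
        (LinearMap.mul ℂ R).compl₂ (L a m.l) from
      LinearMap.congr_fun (LinearMap.congr_fun hs z) x
    refine hR.isUnital.ext fun e z => hR.isUnital.ext fun d x => ?_
    simp only [LinearMap.comp_apply, LinearMap.compl₂_apply, LinearMap.mul_apply', hL, hL']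
    rw [mul_sandwich hR hn h hR₁', sandwich_mul hR hn hR₁, hcomm.apply, opL_tmul, flipConj_tmul]
  let f : A → MultAlg R → MultAlg R := fun a m =>
    MultAlg.mk (L a m.l) (L' a m.r)
      (fun x y => eq_of_mul_left hR.nondegenerate fun z => by
        rw [← hcompat, ← mul_assoc, ← mul_assoc, hcompat])
      (fun x y => eq_of_mul_right hR.nondegenerate fun z => by
        rw [hcompat, mul_assoc, mul_assoc, hcompat])
      (fun x y => hcompat a m x y)
  refine ⟨LinearMap.mk₂ ℂ f ?_ ?_ ?_ ?_, fun a m c x => hL a m.l c x,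
    fun a m c x => hL' a m.r c x⟩
  · intro a a' m
    refine ext_of_l hR.nondegenerate fun x => ?_
    change L (a + a') m.l x = L a m.l x + L a' m.l x
    rw [map_add]; rfl
  · intro c a m
    refine ext_of_l hR.nondegenerate fun x => ?_
    change L (c • a) m.l x = c • L a m.l x
    rw [map_smul]; rfl
  · intro a m m'
    refine ext_of_l hR.nondegenerate fun x => ?_
    change L a (m.l + m'.l) x = L a m.l x + L a m'.l x
    rw [map_add]; rfl
  · intro c a m
    refine ext_of_l hR.nondegenerate fun x => ?_
    change L a (c • m.l) x = c • L a m.l x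
    rw [map_smul]; rfl

end WeakMultiplierHopfAlgebra

end

/-! ### Assembly of the main theorem -/

open MultAlg WeakMultiplierHopfAlgebra in
theorem mainTheorem7 {A : Type*} [NonUnitalRing A] [Module ℂ A] [IsScalarTower ℂ A A]
    [SMulCommClass ℂ A A] (H : RegularWeakMultiplierHopfAlgebra A)
    {R : Type*} [NonUnitalRing R] [Module ℂ R] [IsScalarTower ℂ R R] [SMulCommClass ℂ R R]
    (act : A →ₗ[ℂ] R →ₗ[ℂ] R) (hR : IsModuleAlgebra H.toWeakMultiplierHopfAlgebra act) :
    ∃ (S : A ≃ₗ[ℂ] A) (εt : A →ₗ[ℂ] MultAlg A) (ρ : MultAlg A →ₐ[ℂ] Module.End ℂ R)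
      (ext : A →ₗ[ℂ] MultAlg R →ₗ[ℂ] MultAlg R),
      H.IsAntipode S ∧ H.IsTargetMap εt ∧ IsMultiplierExtension act ρ ∧
      -- `M(R)` is a non-degenerate left `A`-module, and its action extends the one on `R`
      IsLeftAction ext ∧ IsNondegenerateAction ext ∧
      (∀ a x, ext a (MultAlg.incl x) = MultAlg.incl (act a x)) ∧
      -- `(am)r = ∑ a₍₁₎(m(S(a₍₂₎)r))` for `r = S(c)x`, where `S(a₍₂₎)S(c) = S(c a₍₂₎)`
      (∀ (a c : A) (m : MultAlg R) (x : R),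
        (ext a m).l (act (S c) x) =
          TensorProduct.lift (act.compl₂ (m.l ∘ₗ act.flip x ∘ₗ S.toLinearMap)) (H.T₃ (a ⊗ₜ c))) ∧
      -- `r(am) = ∑ a₍₂₎((S⁻¹(a₍₁₎)r)m)` for `r = S⁻¹(c)x`, where `S⁻¹(a₍₁₎)S⁻¹(c) = S⁻¹(c a₍₁₎)`
      (∀ (a c : A) (m : MultAlg R) (x : R),
        (ext a m).r (act (S.symm c) x) =
          TensorProduct.lift (act.compl₂ (m.r ∘ₗ act.flip x ∘ₗ S.symm.toLinearMap)).flip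
            (H.T₂ (c ⊗ₜ a))) ∧
      -- `a1 = ε_t(a)`
      (∀ a x, (ext a 1).l x = ρ (εt a) x) := by
  obtain ⟨K, hK⟩ := H.cop
  have h : IsCop H.toWeakMultiplierHopfAlgebra K := fun a =>
    ext_of_l_of_r (fun x => (hK a x).1) (fun x => (hK a x).2)
  obtain ⟨R₁, hR₁⟩ := H.exists_R₁
  obtain ⟨R₂, hR₂⟩ := H.exists_R₂
  obtain ⟨R₁', hR₁'⟩ := K.exists_R₁
  obtain ⟨S, hS, hS', hm⟩ := h.exists_antipode hR₁ hR₁'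
  have hm' : ∀ a b, S.symm (a * b) = S.symm b * S.symm a := fun a b =>
    S.injective (by rw [hm]; simp)
  obtain ⟨εt, hεt⟩ := h.exists_target hR₁ hS
  have hu := hR.isUnital
  have hn : IsNondegenerateAction act := hu.isNondegenerate h.mem_leftIdeal hR.isLeftAction
  obtain ⟨ρ, hρ, hρ'⟩ := exists_multiplierExtension hR.isLeftAction hu hn
  have hcomm : ∀ {g : Module.End ℂ (A ⊗[ℂ] A)}, LegComm H.T₂ g → LegComm (flipConj R₁') g :=
    h.symm.legComm_flipConj_R₁ hR₁' hS' hm'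
  obtain ⟨ext, hl, hr⟩ := exists_multiplierAction hR hn h hR₁ hR₁' hS hS'
    (hcomm (h.legComm_T₂_R₁ hR₁))
  refine ⟨S, εt, ρ, ext, ⟨R₁, R₂, ⟨hR₁.mul_right, hR₁.mul_left, hR₁.refl⟩,
    ⟨hR₂.mul_right, hR₂.mul_left, hR₂.refl⟩, h.lm₁_R₁ hR₁ hS, fun a b c => ?_⟩, hεt, hρ,
    ?_, ?_, ?_, ?_, ?_, ?_⟩
  -- R₂ is determined by its slice (ι ⊗ ε)R₂(a ⊗ w), which is aS(w) because left and right antipode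
  -- agree.
  · have e : legR H.ε R₂ a = LinearMap.mulLeft ℂ a ∘ₗ S.toLinearMap := by
      refine LinearMap.ext fun w => eq_of_mul_right H.nondegenerate fun y => ?_
      rw [legR_apply, h.slR_R₂_mul hR₁ hR₂, ← hS, ← mul_assoc]
      rfl
    exact (rm₂_of_legComm (legComm_R₂_T₁ hR₂) a b c).trans (by rw [e]; rfl)
  · intro a b m
    refine ext_of_l hR.nondegenerate fun r => ?_
    refine LinearMap.congr_fun (hu.ext fun c x => ?_) r
    rw [hl, hl, h.R₁_mul_tmul hR₁]
    induction R₁ (a ⊗ₜ c) with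
    | zero => simp
    | add z z' hz hz' => simp only [map_add, hz, hz']
    | tmul p q =>
      rw [sandwich_tmul, hl, act_sandwich hR.isLeftAction]
      rfl
  · intro m hm
    refine ext_of_l hR.nondegenerate fun r => ?_
    refine LinearMap.congr_fun (g := (0 : R →ₗ[ℂ] R)) (hu.ext fun c x => ?_) r
    refine hn _ fun a => ?_
    have e : ∀ z, sandwich act m.l x (R₁ z) = 0 := by
      intro z
      induction z with
      | zero => simp
      | add z z' hz hz' => simp only [map_add, hz, hz', add_zero]
      | tmul p q => rw [← hl, hm]; rfl
    -- a(m(cx)) is unchanged when a ⊗ c is replaced by G₁(a ⊗ c) = R₁T₁(a ⊗ c), and on the range of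
    -- R₁ the expression vanishes by assumption.
    rw [← sandwich_tmul, ← sandwich_l_G₁ hR hn h hR₁ hR₁'
      (hcomm (H.legComm_G₁ H.legComm_T₂_T₁)), ← hR₁.apply_left, e]
  · intro a x
    refine ext_of_l hR.nondegenerate fun r => ?_
    refine LinearMap.congr_fun (hu.ext fun c y => ?_) r
    rw [hl, incl_l]
    exact (hR.isInvariantProduct_mul.apply_act hR.isLeftAction hu hn hR₁ a c x y).symm
  · intro a c m x
    have e : H.T₃ (a ⊗ₜ c) = TensorProduct.comm ℂ A A (K.T₂ (c ⊗ₜ a)) :=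
      incl_injective H.nondegenerate₂ ((H.T₃_spec a c).trans (h.incl_comm_T₂ a c).symm)
    rw [hl, h.R₁_tmul_antipode hR₁ hS hm, e]
    induction TensorProduct.comm ℂ A A (K.T₂ (c ⊗ₜ a)) with
    | zero => simp
    | add z z' hz hz' => simp only [map_add, hz, hz']
    | tmul p q => simp
  · intro a c m x
    rw [hr, h.symm.R₁_tmul_antipode hR₁' hS' hm']
    induction H.T₂ (c ⊗ₜ a) with
    | zero => simp
    | add z z' hz hz' => simp only [map_add, hz, hz']
    | tmul p q => simp
  · intro a r
    refine LinearMap.congr_fun (hu.ext fun c x => ?_) r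
    -- Both sides are ∑ a₍₁₎S(a₍₂₎)cx.
    rw [hl, hρ', hεt, slL_E_l_eq hR₁]
    induction R₁ (a ⊗ₜ c) with
    | zero => simp
    | add z z' hz hz' => simp only [map_add, hz, hz', LinearMap.add_apply]
    | tmul p q => simp [hR.isLeftAction p]
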